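/- A finite simple graph is called $c$-closed, for an integer $c\ge 1$, if any two distinct nonadjacent vertices have at most $c-1$ common neighbors. Below, $G$ is a finite simple graph with vertex set $\{0,\dots,n-1\}$, $S$ is a set of $k$ vertices of $G$, and $G-S$ is the subgraph of $G$ induced by the vertices outside $S$. Running times are numbers of steps on a random access machine with increments and decrements as its only arithmetic, where $G$ is given by its adjacency matrix and $S$ by its characteristic vector. Algorithms are uniform: a single program works for all inputs, for all values of $n,k,c$ and $\ell$. (1) There are an algorithm, a constant $C$ and a natural number $a$ such that, whenever $c\ge 1$ and $G-S$ is $c$-closed, the algorithm on input $(G,S)$ enumerates all (inclusion-)maximal cliques of $G$, each exactly once, and halts after at most $C\cdot 2^{k}\cdot 3^{c/3}\cdot (n+1)^{a}$ steps, that is, in $2^{k}\cdot 3^{c/3}\cdot n^{O(1)}$ time. (2) There are an algorithm, a computable function $f:\mathbb N\to\mathbb N$ and a natural number $b$ such that, whenever $c\ge 1$, $G-S$ is $c$-closed and $\ell\in\mathbb N$, the algorithm on input $(G,S,\ell)$ decides whether $G$ contains an independent set of size at least $\ell$ and halts after at most $2^{k}\cdot f(\ell+c)\cdot (n+1)^{b}$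 steps, that is, in $2^{k}\cdot f(\ell+c)\cdot n^{O(1)}$ time. -/

import Mathlib

namespace AlmostClosed

/-! ### Graph notions -/

/-- A finite graph is `c`-closed (for a positive integer `c`) if any two distinct nonadjacent
vertices have at most `c - 1`, that is, fewer than `c`, common neighbors. -/
def IsCClosed {V : Type*} [Finite V] (H : SimpleGraph V) (c : ℕ) : Prop :=
  ∀ u v : V, u ≠ v → ¬ H.Adj u v → (H.commonNeighbors u v).ncard < c

/-- `G - S`, the subgraph induced by the vertices outside `S`. -/
abbrev deleteVerts {V : Type*} (G : SimpleGraph V) (S : Finset V) :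
    SimpleGraph ↥((S : Set V)ᶜ) :=
  G.induce (S : Set V)ᶜ

/-! ### The machine model: a random access machine with unit-cost steps

The state consists of registers, of arrays with indirect addressing, and of an append-only
output tape. All contents are natural numbers. A program is a fixed finite text, so it names
finitely many registers and arrays.

The only arithmetic is increment and decrement. Hence after `t` steps no number exceeds the
largest number of the input and of the program text by more than `t`, and every step is a
constant number of steps of a standard random access machine whose words have logarithmic
length: unit cost does not hide any work. -/

/-- A state of the machine: registers, arrays, and the output written so far. -/
structure State where
  reg : ℕ → ℕ
  arr : ℕ → ℕ → ℕ
  out : List ℕ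

/-- Write the number `m` into the register `x`. -/
def State.setReg (s : State) (x m : ℕ) : State :=
  { s with reg := Function.update s.reg x m }

/-- Write the number `m` into cell `i` of the array `a`. -/
def State.setArr (s : State) (a i m : ℕ) : State :=
  { s with arr := Function.update s.arr a (Function.update (s.arr a) i m) }

/-- Append the number `m` to the output. -/
def State.emit (s : State) (m : ℕ) : State :=
  { s with out := s.out ++ [m] }

/-- Structured programs; `x`, `y` are names of registers, `a` is the name of an array. -/
inductive Prog : Type
  | skip : Prog
  /-- `x := m` for a literal `m` -/
  | const (x m : ℕ) : Prog
  /-- `x := y` -/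
  | copy (x y : ℕ) : Prog
  /-- `x := x + 1` -/
  | incr (x : ℕ) : Prog
  /-- `x := x - 1`, where `0` stays `0` -/
  | decr (x : ℕ) : Prog
  /-- `x := a[y]` -/
  | load (x a y : ℕ) : Prog
  /-- `a[y] := x` -/
  | store (a y x : ℕ) : Prog
  /-- append the content of `x` to the output -/
  | emit (x : ℕ) : Prog
  /-- `P; Q` -/
  | seq (P Q : Prog) : Prog
  /-- `if x < y then P else Q` -/
  | ifLt (x y : ℕ) (P Q : Prog) : Prog
  /-- `while x < y do P` -/
  | whileLt (x y : ℕ) (P : Prog) : Prog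

/-- `Run P s t s'`: the program `P`, started in the state `s`, halts after exactly `t` steps in
the state `s'`. Every elementary instruction and every evaluation of a test is one step. -/
inductive Run : Prog → State → ℕ → State → Prop
  | skip (s : State) : Run .skip s 1 s
  | const (s : State) (x m : ℕ) : Run (.const x m) s 1 (s.setReg x m)
  | copy (s : State) (x y : ℕ) : Run (.copy x y) s 1 (s.setReg x (s.reg y))
  | incr (s : State) (x : ℕ) : Run (.incr x) s 1 (s.setReg x (s.reg x + 1))
  | decr (s : State) (x : ℕ) : Run (.decr x) s 1 (s.setReg x (s.reg x - 1))
  | load (s : State) (x a y : ℕ) : Run (.load x a y) s 1 (s.setReg x (s.arr a (s.reg y)))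
  | store (s : State) (a y x : ℕ) : Run (.store a y x) s 1 (s.setArr a (s.reg y) (s.reg x))
  | emit (s : State) (x : ℕ) : Run (.emit x) s 1 (s.emit (s.reg x))
  | seq {P Q : Prog} {s s₁ s₂ : State} {t₁ t₂ : ℕ} :
      Run P s t₁ s₁ → Run Q s₁ t₂ s₂ → Run (.seq P Q) s (t₁ + t₂) s₂
  | ifTrue {x y : ℕ} {P Q : Prog} {s s' : State} {t : ℕ} :
      s.reg x < s.reg y → Run P s t s' → Run (.ifLt x y P Q) s (t + 1) s'
  | ifFalse {x y : ℕ} {P Q : Prog} {s s' : State} {t : ℕ} :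
      ¬ s.reg x < s.reg y → Run Q s t s' → Run (.ifLt x y P Q) s (t + 1) s'
  | whileDone {x y : ℕ} {P : Prog} {s : State} :
      ¬ s.reg x < s.reg y → Run (.whileLt x y P) s 1 s
  | whileStep {x y : ℕ} {P : Prog} {s s₁ s₂ : State} {t₁ t₂ : ℕ} :
      s.reg x < s.reg y → Run P s t₁ s₁ → Run (.whileLt x y P) s₁ t₂ s₂ →
        Run (.whileLt x y P) s (t₁ + t₂ + 1) s₂

/-- The machine is deterministic: the running time and the final state are well defined. -/
theorem Run.det {P : Prog} {s s₁ s₂ : State} {t₁ t₂ : ℕ}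
    (h₁ : Run P s t₁ s₁) (h₂ : Run P s t₂ s₂) : t₁ = t₂ ∧ s₁ = s₂ := by
  induction h₁ generalizing t₂ s₂ with
  | seq _ _ ihP ihQ =>
    cases h₂ with
    | seq a b =>
      obtain ⟨rfl, rfl⟩ := ihP a
      obtain ⟨rfl, rfl⟩ := ihQ b
      exact ⟨rfl, rfl⟩
  | ifTrue h _ ih =>
    cases h₂ with
    | ifTrue _ a => obtain ⟨rfl, rfl⟩ := ih a; exact ⟨rfl, rfl⟩
    | ifFalse h' _ => exact absurd h h'
  | ifFalse h _ ih =>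
    cases h₂ with
    | ifTrue h' _ => exact absurd h' h
    | ifFalse _ a => obtain ⟨rfl, rfl⟩ := ih a; exact ⟨rfl, rfl⟩
  | whileDone h =>
    cases h₂ with
    | whileDone _ => exact ⟨rfl, rfl⟩
    | whileStep h' _ _ => exact absurd h' h
  | whileStep h _ _ ihP ihW =>
    cases h₂ with
    | whileDone h' => exact absurd h h'
    | whileStep _ a b =>
      obtain ⟨rfl, rfl⟩ := ihP a
      obtain ⟨rfl, rfl⟩ := ihW b
      exact ⟨rfl, rfl⟩
  | _ => cases h₂; exact ⟨rfl, rfl⟩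

/-- `P` started in `s` halts after exactly `t` steps and its output is `w`. -/
def Outputs (P : Prog) (s : State) (t : ℕ) (w : List ℕ) : Prop :=
  ∃ s' : State, Run P s t s' ∧ s'.out = w

/-! ### Encoding of inputs and outputs -/

open Classical in
/-- The initial state for a graph `G` on the vertices `0, …, n - 1`, a vertex set `S` and a
number `p`: register `0` holds `n`, register `1` holds `p`, array `0` holds the adjacency matrix
of `G` row by row, array `1` holds the characteristic vector of `S`; everything else is `0`, and
the output is empty. -/
noncomputable def inputState {n : ℕ} (G : SimpleGraph (Fin n)) (S : Finset (Fin n)) (p : ℕ) :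
    State where
  reg x := if x = 0 then n else if x = 1 then p else 0
  arr a i :=
    if a = 0 then (if ∃ u v : Fin n, G.Adj u v ∧ i = u.val * n + v.val then 1 else 0)
    else if a = 1 then (if ∃ v ∈ S, i = v.val then 1 else 0)
    else 0
  out := []

/-- The code word of a vertex set: its vertices in increasing order, with the vertex `v` written
as the number `v + 1`, followed by the end marker `0`. -/
def encodeSet {n : ℕ} (K : Finset (Fin n)) : List ℕ :=
  (K.sort (· ≤ ·)).map (fun v => v.val + 1) ++ [0]

/-- The word `w` enumerates the maximal cliques of `G`: it is the concatenation, in some order,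
of the code words of the maximal cliques of `G`, each of them occurring exactly once. -/
def EnumeratesMaximalCliques {n : ℕ} (G : SimpleGraph (Fin n)) (w : List ℕ) : Prop :=
  ∃ L : List (Finset (Fin n)), L.Nodup ∧
    (∀ K : Finset (Fin n), K ∈ L ↔
      Maximal (fun T : Finset (Fin n) => G.IsClique (T : Set (Fin n))) K) ∧
    w = L.flatMap encodeSet

/-- `G` contains an independent set of size at least `l`. -/
def HasIndepSet {n : ℕ} (G : SimpleGraph (Fin n)) (l : ℕ) : Prop :=
  ∃ I : Finset (Fin n), G.IsIndepSet (I : Set (Fin n)) ∧ l ≤ I.card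

end AlmostClosed

/-! Both algorithms are breadth-first searches over vertex sets. A level costs its length times a
polynomial in `n`, so the time bounds follow from bounds on the lengths of the levels.

Cliques. The vertices are inserted one by one, and the list of all maximal cliques of the graph
induced by the prefix `W` is maintained. Let `M` be a maximal clique of `W + v`. If `v` is not in
`M`, then `M` is maximal in `W` and is its own parent. If `M - v` is maximal in `W`, it is the
parent. Otherwise the parent is the greedy extension of `M - v` inside `W`, in increasing order of
vertices. The parent is unique and can be recognized from `v` and the parent alone, so every `M` is
produced exactly once without comparing `M` to other sets (`mem_maxCliques_insert`,
`nodup_flatMap_extendClique`). The levels are short for three reasons. Any `m` vertices carry at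
most `3 ^ (m / 3)` maximal cliques (Moon and Moser, `card_maxCliques_le`). In a `c`-closed graph a
new vertex `v` creates at most `3 ^ (c / 3)` additional maximal cliques for each nonneighbor `u`,
since these live in the common neighborhood of `u` and `v` (`card_maxCliques_le_of_closed`).
Finally, fixing the trace of the clique on `S` costs a factor `2 ^ k`
(`card_maxCliques_le_two_pow_mul`). All this applies to every prefix, because closedness passes to
induced subgraphs.

Independent sets. The trace on `S` is guessed in at most `2 ^ k` ways. Outside `S`, let `d₀` be the
largest number of common neighbors of two nonadjacent vertices, and call the first free vertex with
at most `d₀ * l` later free neighbors the pivot. A vertex before the pivot has so many later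
neighbors that in any independent set of size at most `l` it can be exchanged for one of them: the
other members block at most `d₀` of them each. Hence some solution of the same size contains the
pivot or one of its later neighbors (`exists_mem_candidates`), and `l` rounds of branching into at
most `d₀ * l + 1` cases suffice (`hasIndepSet_iff`). Since `c` is not part of the input, the machine
computes `d₀`, which is below `c`.

Machine. Formulas with counting quantifiers over vertices compile to code of polynomial cost
(`Expr.reach_code`), and commands append definable sets to a queue (`Cmd.reach_code`). What remains
for each algorithm is that the meaning of one command equals the mathematical branching step. -/

namespace AlmostClosed

/-! ### States -/

@[simp, grind =] theorem State.setReg_reg (s : State) (x m y : ℕ) :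
    (s.setReg x m).reg y = if y = x then m else s.reg y := by
  simp [State.setReg, Function.update_apply]

@[simp, grind =] theorem State.setReg_arr (s : State) (x m : ℕ) : (s.setReg x m).arr = s.arr := rfl

@[simp, grind =] theorem State.setReg_out (s : State) (x m : ℕ) : (s.setReg x m).out = s.out := rfl

@[simp, grind =] theorem State.setArr_reg (s : State) (a i m : ℕ) :
    (s.setArr a i m).reg = s.reg := rfl

@[simp, grind =] theorem State.setArr_arr (s : State) (a i m b j : ℕ) :
    (s.setArr a i m).arr b j = if b = a ∧ j = i then m else s.arr b j := by
  by_cases hb : b = a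
  · subst hb
    simp [State.setArr, Function.update_apply]
  · simp [State.setArr, hb]

@[simp, grind =] theorem State.setArr_out (s : State) (a i m : ℕ) :
    (s.setArr a i m).out = s.out := rfl

@[simp, grind =] theorem State.emit_reg (s : State) (m : ℕ) : (s.emit m).reg = s.reg := rfl

@[simp, grind =] theorem State.emit_arr (s : State) (m : ℕ) : (s.emit m).arr = s.arr := rfl

@[simp, grind =] theorem State.emit_out (s : State) (m : ℕ) : (s.emit m).out = s.out ++ [m] := rfl

/-! ### Total correctness with a time bound -/

/-- Started in `s`, the program `P` halts within `T` steps in a state that satisfies `Q`. -/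
def Reach (P : Prog) (s : State) (T : ℕ) (Q : State → Prop) : Prop :=
  ∃ t s', Run P s t s' ∧ t ≤ T ∧ Q s'

namespace Reach

variable {P P' : Prog} {s : State} {T T' : ℕ} {Q R : State → Prop} {x y a m : ℕ}

theorem mono (h : Reach P s T R) (hT : T ≤ T') (hQ : ∀ s', R s' → Q s') : Reach P s T' Q := by
  obtain ⟨t, s', hr, ht, hs⟩ := h
  exact ⟨t, s', hr, ht.trans hT, hQ _ hs⟩

theorem seq (h : Reach P s T R) (h' : ∀ s', R s' → Reach P' s' T' Q) :
    Reach (.seq P P') s (T + T') Q := by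
  obtain ⟨t, s', hr, ht, hs⟩ := h
  obtain ⟨t', s'', hr', ht', hs'⟩ := h' _ hs
  exact ⟨_, _, hr.seq hr', add_le_add ht ht', hs'⟩

theorem skip (h : Q s) : Reach .skip s 1 Q := ⟨_, _, .skip s, le_rfl, h⟩

theorem const (h : Q (s.setReg x m)) : Reach (.const x m) s 1 Q :=
  ⟨_, _, .const s x m, le_rfl, h⟩

theorem copy (h : Q (s.setReg x (s.reg y))) : Reach (.copy x y) s 1 Q :=
  ⟨_, _, .copy s x y, le_rfl, h⟩

theorem incr (h : Q (s.setReg x (s.reg x + 1))) : Reach (.incr x) s 1 Q :=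
  ⟨_, _, .incr s x, le_rfl, h⟩

theorem load (h : Q (s.setReg x (s.arr a (s.reg y)))) : Reach (.load x a y) s 1 Q :=
  ⟨_, _, .load s x a y, le_rfl, h⟩

theorem store (h : Q (s.setArr a (s.reg y) (s.reg x))) : Reach (.store a y x) s 1 Q :=
  ⟨_, _, .store s a y x, le_rfl, h⟩

theorem emit (h : Q (s.emit (s.reg x))) : Reach (.emit x) s 1 Q :=
  ⟨_, _, .emit s x, le_rfl, h⟩

/-- Taking equality with the explicit next state as the intermediate postcondition turns sequencing
into symbolic execution. -/
theorem constSeq (h : Reach P (s.setReg x m) T Q) : Reach (.seq (.const x m) P) s (T + 1) Q :=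
  (seq (const (Q := (· = s.setReg x m)) rfl) (by rintro _ rfl; exact h)).mono (by omega)
    fun _ => id

theorem copySeq (h : Reach P (s.setReg x (s.reg y)) T Q) : Reach (.seq (.copy x y) P) s (T + 1) Q :=
  (seq (copy (Q := (· = s.setReg x (s.reg y))) rfl) (by rintro _ rfl; exact h)).mono (by omega)
    fun _ => id

theorem incrSeq (h : Reach P (s.setReg x (s.reg x + 1)) T Q) :
    Reach (.seq (.incr x) P) s (T + 1) Q :=
  (seq (incr (Q := (· = s.setReg x (s.reg x + 1))) rfl) (by rintro _ rfl; exact h)).mono (by omega)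
    fun _ => id

theorem loadSeq (h : Reach P (s.setReg x (s.arr a (s.reg y))) T Q) :
    Reach (.seq (.load x a y) P) s (T + 1) Q :=
  (seq (load (Q := (· = s.setReg x (s.arr a (s.reg y)))) rfl) (by rintro _ rfl; exact h)).mono
    (by omega) fun _ => id

theorem storeSeq (h : Reach P (s.setArr a (s.reg y) (s.reg x)) T Q) :
    Reach (.seq (.store a y x) P) s (T + 1) Q :=
  (seq (store (Q := (· = s.setArr a (s.reg y) (s.reg x))) rfl) (by rintro _ rfl; exact h)).mono
    (by omega) fun _ => id

theorem ifLt (h : s.reg x < s.reg y → Reach P s T Q) (h' : ¬ s.reg x < s.reg y → Reach P' s T Q) :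
    Reach (.ifLt x y P P') s (T + 1) Q := by
  by_cases hxy : s.reg x < s.reg y
  · obtain ⟨t, s', hr, ht, hs⟩ := h hxy
    exact ⟨_, _, .ifTrue hxy hr, by omega, hs⟩
  · obtain ⟨t, s', hr, ht, hs⟩ := h' hxy
    exact ⟨_, _, .ifFalse hxy hr, by omega, hs⟩

/-- A loop whose invariant `I j` holds after `j` rounds and which makes `N` rounds. -/
theorem loop (I : ℕ → State → Prop) (N : ℕ)
    (hI : ∀ j s, j ≤ N → I j s → (s.reg x < s.reg y ↔ j < N))
    (hP : ∀ j s, j < N → I j s → Reach P s T (I (j + 1))) (h : I 0 s) :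
    Reach (.whileLt x y P) s (N * (T + 1) + 1) (I N) := by
  suffices H : ∀ m j s, j + m = N → I j s → Reach (.whileLt x y P) s (m * (T + 1) + 1) (I N) from
    H N 0 s (by omega) h
  intro m
  induction m with
  | zero =>
    intro j s hj hs
    obtain rfl : j = N := by omega
    exact ⟨_, _, .whileDone (by rw [hI _ _ le_rfl hs]; exact lt_irrefl _), by omega, hs⟩
  | succ m ih =>
    intro j s hj hs
    obtain ⟨t, s', hr, ht, hs'⟩ := hP j s (by omega) hs
    obtain ⟨t', s'', hr', ht', hs''⟩ := ih (j + 1) s' (by omega) hs'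
    exact ⟨_, _, .whileStep ((hI _ _ (by omega) hs).2 (by omega)) hr hr',
      by rw [Nat.add_mul]; omega, hs''⟩

end Reach

/-! ### Expressions -/

/-- Expressions with counting quantifiers over the numbers below the content of register `0`. -/
inductive Expr : Type
  | reg (x : ℕ) : Expr
  | lit (m : ℕ) : Expr
  | get (a x : ℕ) : Expr
  | adj (x y : ℕ) : Expr
  | lt (e f : Expr) : Expr
  | ite (e f g : Expr) : Expr
  | count (i : ℕ) (e : Expr) : Expr

namespace Expr

/-- The value of an expression in a state. -/
def eval : Expr → State → ℕ
  | reg x, s => s.reg x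
  | lit m, _ => m
  | get a x, s => s.arr a (s.reg x)
  -- The guard keeps the counting loops that compute the matrix index polynomial in `n`, whatever
  -- the registers contain.
  | adj x y, s =>
    if s.reg x < s.reg 0 ∧ s.reg y < s.reg 0 then s.arr 0 (s.reg x * s.reg 0 + s.reg y) else 0
  | lt e f, s => if e.eval s < f.eval s then 1 else 0
  | ite e f g, s => if 0 < e.eval s then f.eval s else g.eval s
  | count i e, s => ((Finset.range (s.reg 0)).filter fun j => 0 < e.eval (s.setReg i j)).card

/-- All registers of the expression are smaller than `r`, it does not read the array `2`, and it
does not bind the register `0`. -/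
def WF (r : ℕ) : Expr → Prop
  | reg x => x < r
  | lit _ => True
  | get a x => a ≠ 2 ∧ x < r
  | adj x y => x < r ∧ y < r
  | lt e f => e.WF r ∧ f.WF r
  | ite e f g => e.WF r ∧ f.WF r ∧ g.WF r
  | count i e => 0 < i ∧ i < r ∧ e.WF r

theorem WF.mono {e : Expr} {r r' : ℕ} (h : e.WF r) (hr : r ≤ r') : e.WF r' := by
  induction e <;> simp_all only [WF] <;> grind

/-- Scratch registers and the queue are invisible to a well-formed expression, so its meaning
survives the evaluation of other expressions and the growth of the queue. -/
theorem eval_congr {e : Expr} {r : ℕ} (h : e.WF r) (hr : 0 < r) {s s' : State}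
    (hreg : ∀ x < r, s'.reg x = s.reg x) (harr : ∀ a, a ≠ 2 → s'.arr a = s.arr a) :
    e.eval s' = e.eval s := by
  induction e generalizing s s' with
  | reg x => exact hreg x h
  | lit m => rfl
  | get a x => simp only [eval, harr a h.1, hreg x h.2]
  | adj x y => simp only [eval, harr 0 (by simp), hreg x h.1, hreg y h.2, hreg 0 hr]
  | lt e f ihe ihf => simp only [eval, ihe h.1 hreg harr, ihf h.2 hreg harr]
  | ite e f g ihe ihf ihg =>
    simp only [eval, ihe h.1 hreg harr, ihf h.2.1 hreg harr, ihg h.2.2 hreg harr]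
  | count i e ih =>
    simp only [eval, hreg 0 hr]
    congr 1
    refine Finset.filter_congr fun j _ => ?_
    rw [ih h.2.2 (s := s.setReg i j) (s' := s'.setReg i j) _ harr]
    intro x hx
    simp [hreg x hx]

/-- The code that evaluates an expression. The value is left in the register `r`; only registers
from `r` on are used as scratch space. -/
def code : Expr → ℕ → Prog
  | reg x, r => .copy r x
  | lit m, r => .const r m
  | get a x, r => .load r a x
  | adj x y, r =>
    .seq (.const r 0) <| .ifLt x 0 (.ifLt y 0
      (.seq (.const (r + 1) 0) <| .seq (.const (r + 2) 0) <|
        .seq (.whileLt (r + 2) x <| .seq (.const (r + 3) 0) <|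
          .seq (.whileLt (r + 3) 0 <| .seq (.incr (r + 1)) (.incr (r + 3))) (.incr (r + 2))) <|
        .seq (.const (r + 3) 0) <|
        .seq (.whileLt (r + 3) y <| .seq (.incr (r + 1)) (.incr (r + 3))) (.load r 0 (r + 1)))
      .skip) .skip
  | lt e f, r =>
    .seq (e.code r) <| .seq (f.code (r + 1)) <| .ifLt r (r + 1) (.const r 1) (.const r 0)
  | ite e f g, r =>
    .seq (e.code r) <| .seq (.const (r + 1) 0) <| .ifLt (r + 1) r (f.code r) (g.code r)
  | count i e, r =>
    -- The bound register lies below `r` and must be preserved, so its old content is parked in `r +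
    -- 1` and restored at the end.
    .seq (.copy (r + 1) i) <| .seq (.const r 0) <| .seq (.const i 0) <|
      .seq (.whileLt i 0 <| .seq (e.code (r + 2)) <| .seq (.const (r + 3) 0) <|
        .seq (.ifLt (r + 3) (r + 2) (.incr r) .skip) (.incr i)) (.copy i (r + 1))

/-- A bound for the running time of the code. -/
def cost : Expr → ℕ → ℕ
  | reg _, _ => 1
  | lit _, _ => 1
  | get _ _, _ => 1
  | adj _ _, n => n * (n * 3 + 4) + n * 3 + 9
  | lt e f, n => e.cost n + f.cost n + 2
  | ite e f g, n => e.cost n + f.cost n + g.cost n + 2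
  | count _ e, n => n * (e.cost n + 5) + 5

/-- A subexpression writes only from its own target register on. Placing the targets of later
subexpressions higher therefore protects intermediate values, and loop variables are safe because
they lie below `r`. -/
theorem reach_code (e : Expr) {r : ℕ} (h : e.WF r) (hr : 0 < r) (s : State) :
    Reach (e.code r) s (e.cost (s.reg 0)) fun s' =>
      (∀ x < r, s'.reg x = s.reg x) ∧ s'.arr = s.arr ∧ s'.out = s.out ∧
        s'.reg r = e.eval s := by
  induction e generalizing r s with
  | reg x => exact .copy (by simp [eval]; grind)
  | lit m => exact .const (by simp [eval]; grind)
  | get a x => exact .load (by simp [eval]; grind)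
  | adj x y =>
    obtain ⟨hx, hy⟩ := h
    set n := s.reg 0 with hn
    refine (Reach.constSeq (T := n * (n * 3 + 4) + n * 3 + 8) ?_).mono (by simp [cost])
      fun _ => id
    refine (Reach.ifLt (T := n * (n * 3 + 4) + n * 3 + 7) (fun h1 => ?_) fun h1 =>
      (Reach.skip ?_).mono (by omega) fun _ => id)
    swap
    · simp only [State.setReg_reg] at h1
      simp [eval]
      grind
    refine (Reach.ifLt (T := n * (n * 3 + 4) + n * 3 + 6) (fun h2 => ?_) fun h2 =>
      (Reach.skip ?_).mono (by omega) fun _ => id)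
    swap
    · simp only [State.setReg_reg] at h2
      simp [eval]
      grind
    have h1' : s.reg x < n := by simpa [hx.ne, hr.ne] using h1
    have h2' : s.reg y < n := by simpa [hy.ne, hr.ne] using h2
    refine (Reach.constSeq <| Reach.constSeq <| Reach.seq
      (T := s.reg x * (n * 3 + 4) + 1) (R := fun s' => (∀ z < r, s'.reg z = s.reg z) ∧
        s'.arr = s.arr ∧ s'.out = s.out ∧ s'.reg (r + 1) = s.reg x * n)
      (T' := s.reg y * 3 + 3) ?_ ?_).mono (by
        have : s.reg x * (n * 3 + 4) ≤ n * (n * 3 + 4) := by gcongr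
        omega) fun _ => id
    · refine (Reach.loop (T := n * 3 + 3) (fun j s' => (∀ z < r, s'.reg z = s.reg z) ∧
        s'.arr = s.arr ∧ s'.out = s.out ∧ s'.reg (r + 1) = j * n ∧ s'.reg (r + 2) = j) (s.reg x)
        ?_ ?_ ?_).mono le_rfl ?_
      · rintro j s' - ⟨h1, -, -, -, h2⟩
        rw [h1 x hx, h2]
      · rintro j s' hj ⟨g1, g2, g3, g4, g5⟩
        refine (Reach.constSeq <| Reach.seq (Reach.loop (T := 2) (fun i s' =>
          (∀ z < r, s'.reg z = s.reg z) ∧ s'.arr = s.arr ∧ s'.out = s.out ∧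
          s'.reg (r + 1) = j * n + i ∧ s'.reg (r + 2) = j ∧ s'.reg (r + 3) = i) n ?_ ?_ ?_)
          (T' := 1) ?_).mono (by omega) fun _ => id
        · rintro i s'' - ⟨k1, -, -, -, -, k2⟩
          rw [k1 0 hr, k2]
        · rintro i s'' hi ⟨k1, k2, k3, k4, k5, k6⟩
          refine Reach.incrSeq (Reach.incr ?_)
          simp
          grind
        · simp
          grind
        · rintro s'' ⟨k1, k2, k3, k4, k5, k6⟩
          refine Reach.incr ?_
          simp
          grind
      · simp
        grind
      · grind
    · rintro s' ⟨g1, g2, g3, g4⟩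
      refine (Reach.constSeq <| Reach.seq (Reach.loop (T := 2) (fun i s' =>
          (∀ z < r, s'.reg z = s.reg z) ∧ s'.arr = s.arr ∧ s'.out = s.out ∧
          s'.reg (r + 1) = s.reg x * n + i ∧ s'.reg (r + 3) = i) (s.reg y) ?_ ?_ ?_)
          (T' := 1) ?_).mono (by omega) fun _ => id
      · rintro i s'' - ⟨k1, -, -, -, k2⟩
        rw [k1 y hy, k2]
      · rintro i s'' hi ⟨k1, k2, k3, k4, k5⟩
        refine Reach.incrSeq (Reach.incr ?_)
        simp
        grind
      · simp
        grind
      · rintro s'' ⟨k1, k2, k3, k4, k5⟩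
        refine Reach.load ?_
        simp [eval]
        grind
  | lt e f ihe ihf =>
    refine (Reach.seq (T' := f.cost (s.reg 0) + 2) (ihe h.1 hr s) ?_).mono (by simp [cost]; omega)
      fun _ => id
    rintro s' ⟨h1, h2, h3, h4⟩
    rw [← h1 0 hr]
    refine Reach.seq (ihf (r := r + 1) (h.2.mono (Nat.le_succ r)) (Nat.succ_pos r) s') ?_
    rintro s'' ⟨k1, k2, k3, k4⟩
    refine Reach.ifLt (T := 1) (fun hlt => Reach.const ?_) fun hlt => Reach.const ?_
    · rw [eval_congr h.2 hr h1 fun a _ => by rw [h2]] at k4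
      simp [eval]
      grind
    · rw [eval_congr h.2 hr h1 fun a _ => by rw [h2]] at k4
      simp [eval]
      grind
  | ite e f g ihe ihf ihg =>
    refine (Reach.seq (ihe h.1 hr s) fun s' ⟨h1, h2, h3, h4⟩ => Reach.constSeq <|
      Reach.ifLt (T := f.cost (s.reg 0) + g.cost (s.reg 0)) (fun hlt =>
      (ihf h.2.1 hr _).mono ?_ ?_) fun hlt => (ihg h.2.2 hr _).mono ?_ ?_).mono ?_ fun _ => id
    · simp [h1 0 hr]
    · rintro s'' ⟨k1, k2, k3, k4⟩
      rw [eval_congr h.2.1 hr (s := s) (by simp; grind) (by simp [h2])] at k4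
      simp [eval]
      grind
    · simp [h1 0 hr]
    · rintro s'' ⟨k1, k2, k3, k4⟩
      rw [eval_congr h.2.2 hr (s := s) (by simp; grind) (by simp [h2])] at k4
      simp [eval]
      grind
    · rw [cost]
      omega
  | count i e ih =>
    obtain ⟨hi, hir, he⟩ := h
    set n := s.reg 0 with hn
    refine (Reach.copySeq <| Reach.constSeq <| Reach.constSeq <| Reach.seq
      (T := n * (e.cost n + 5) + 1)
      (Reach.loop (T := e.cost n + 4) (fun j s' => (∀ z < r, z ≠ i → s'.reg z = s.reg z) ∧
        s'.arr = s.arr ∧ s'.out = s.out ∧ s'.reg (r + 1) = s.reg i ∧ s'.reg i = j ∧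
        s'.reg r = ((Finset.range j).filter fun j => 0 < e.eval (s.setReg i j)).card) n
        ?_ ?_ ?_) (T' := 1) ?_).mono (by simp [cost]) fun _ => id
    · rintro j s' - ⟨h1, -, -, -, h2, -⟩
      rw [h1 0 hr (by omega), h2]
    · rintro j s' hj ⟨h1, h2, h3, h4, h5, h6⟩
      rw [hn, ← h1 0 hr (by omega)]
      refine Reach.seq (ih (he.mono (by omega)) (by omega) s') ?_
      rintro s'' ⟨k1, k2, k3, k4⟩
      rw [eval_congr he hr (s := s.setReg i j) (by simp; grind) (by simp [h2])] at k4
      refine Reach.constSeq <| Reach.seq (T := 2) (T' := 1) (Reach.ifLt (T := 1) (Q := fun s'' =>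
        (∀ z < r, z ≠ i → s''.reg z = s.reg z) ∧ s''.arr = s.arr ∧ s''.out = s.out ∧
        s''.reg (r + 1) = s.reg i ∧ s''.reg i = j ∧ s''.reg r =
        ((Finset.range (j + 1)).filter fun j => 0 < e.eval (s.setReg i j)).card)
        (fun hlt => Reach.incr ?_) fun hlt => Reach.skip ?_) ?_
      · rw [Finset.range_add_one, Finset.filter_insert, if_pos (by simp_all),
          Finset.card_insert_of_notMem (by simp)]
        simp
        grind
      · rw [Finset.range_add_one, Finset.filter_insert, if_neg (by simp_all)]
        simp
        grind
      · rintro s3 ⟨l1, l2, l3, l4, l5, l6⟩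
        refine Reach.incr ?_
        simp
        grind
    · simp
      grind
    · rintro s' ⟨h1, h2, h3, h4, h5, h6⟩
      refine Reach.copy ?_
      simp [eval]
      grind

end Expr

end AlmostClosed

namespace AlmostClosed

/-! ### Formulas -/

namespace Expr

/-- An expression, read as a formula, is satisfied if its value is positive. -/
def Sat (e : Expr) (s : State) : Prop := 0 < e.eval s

instance (e : Expr) (s : State) : Decidable (e.Sat s) := inferInstanceAs (Decidable (0 < _))

theorem sat_congr {e : Expr} {r : ℕ} (h : e.WF r) (hr : 0 < r) {s s' : State}
    (hreg : ∀ x < r, s'.reg x = s.reg x) (harr : ∀ a, a ≠ 2 → s'.arr a = s.arr a) :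
    e.Sat s' ↔ e.Sat s := by
  rw [Sat, Sat, eval_congr h hr hreg harr]

/-- Negation. -/
def not (e : Expr) : Expr := .ite e (.lit 0) (.lit 1)

/-- Conjunction. -/
def and (e f : Expr) : Expr := .ite e f (.lit 0)

/-- Disjunction. -/
def or (e f : Expr) : Expr := .ite e (.lit 1) f

/-- Existential quantification over the numbers below the content of register `0`. -/
def ex (i : ℕ) (e : Expr) : Expr := .lt (.lit 0) (.count i e)

/-- Universal quantification over the numbers below the content of register `0`. -/
def all (i : ℕ) (e : Expr) : Expr := (ex i e.not).not

/-- The contents of two registers are equal. -/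
def eq (x y : ℕ) : Expr := (Expr.lt (.reg x) (.reg y)).or (.lt (.reg y) (.reg x)) |>.not

variable {s : State}

@[simp] theorem sat_not {e : Expr} : e.not.Sat s ↔ ¬ e.Sat s := by
  simp only [Sat, not, eval]
  split_ifs with h <;> simp [h]

@[simp] theorem sat_and {e f : Expr} : (e.and f).Sat s ↔ e.Sat s ∧ f.Sat s := by
  simp only [Sat, and, eval]
  split_ifs with h <;> simp [h]

@[simp] theorem sat_or {e f : Expr} : (e.or f).Sat s ↔ e.Sat s ∨ f.Sat s := by
  simp only [Sat, or, eval]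
  split_ifs with h <;> simp [h]

theorem sat_lt {e f : Expr} : (Expr.lt e f).Sat s ↔ e.eval s < f.eval s := by
  simp only [Sat, eval]
  split_ifs with h <;> simp [h]

@[simp] theorem sat_eq {x y : ℕ} : (eq x y).Sat s ↔ s.reg x = s.reg y := by
  simp only [eq, sat_not, sat_or, sat_lt, eval]
  omega

/-- Passing from numbers below `n` to `Fin n` makes formulas speak about vertices. -/
theorem eval_count {n : ℕ} (hn : s.reg 0 = n) {i : ℕ} {e : Expr} :
    (Expr.count i e).eval s =
      (Finset.univ.filter fun j : Fin n => e.Sat (s.setReg i j)).card := by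
  simp only [eval, hn]
  refine (Finset.card_bij (fun j _ => j.val) ?_ ?_ ?_).symm
  · intro j hj
    rw [Finset.mem_filter, Finset.mem_range]
    exact ⟨j.2, (Finset.mem_filter.1 hj).2⟩
  · intro a _ b _ h
    exact Fin.ext h
  · intro j hj
    rw [Finset.mem_filter, Finset.mem_range] at hj
    exact ⟨⟨j, hj.1⟩, Finset.mem_filter.2 ⟨Finset.mem_univ _, hj.2⟩, rfl⟩

theorem sat_ex {n : ℕ} (hn : s.reg 0 = n) {i : ℕ} {e : Expr} :
    (ex i e).Sat s ↔ ∃ j : Fin n, e.Sat (s.setReg i j) := by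
  rw [ex, sat_lt, eval_count hn]
  simp [eval, Finset.card_pos, Finset.Nonempty]

theorem sat_all {n : ℕ} (hn : s.reg 0 = n) {i : ℕ} {e : Expr} :
    (all i e).Sat s ↔ ∀ j : Fin n, e.Sat (s.setReg i j) := by
  simp [all, sat_ex hn]

end Expr

/-! ### Compilation of commands that append definable vertex sets -/

/-! ### The queue

The machine keeps a queue of vertex sets in the array `2`; every set is a block of `n` bits. The
registers `14` and `15` hold the number of blocks and the address of the end of the queue, the
registers `12` and `13` the number of the head block and its address. The array `3` holds the
current set. -/

/-- The queue of the machine is `q`. -/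
structure IsQueue {n : ℕ} (q : List (Finset (Fin n))) (s : State) : Prop where
  length : s.reg 14 = q.length
  addr : s.reg 15 = q.length * n
  mem : ∀ (j : ℕ) (hj : j < q.length) (u : Fin n),
    s.arr 2 (j * n + u) = if u ∈ q[j] then 1 else 0

/-- The current set is `K`. -/
def IsCurrent {n : ℕ} (K : Finset (Fin n)) (s : State) : Prop :=
  ∀ u : Fin n, s.arr 3 u = if u ∈ K then 1 else 0

/-- The two states differ at most in the queue and in scratch registers. -/
structure Frame (s s' : State) : Prop where
  reg : ∀ x < 17, x ≠ 14 → x ≠ 15 → s'.reg x = s.reg x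
  arr : ∀ a, a ≠ 2 → s'.arr a = s.arr a
  out : s'.out = s.out

theorem Frame.refl (s : State) : Frame s s := ⟨by simp, by simp, rfl⟩

theorem Frame.trans {s s' s'' : State} (h : Frame s s') (h' : Frame s' s'') : Frame s s'' :=
  ⟨fun x a b c => (h'.reg x a b c).trans (h.reg x a b c), fun a h0 => (h'.arr a h0).trans (h.arr a h0),
    h'.out.trans h.out⟩

/-- Commands that append sets to the queue. -/
inductive Cmd : Type
  | nil : Cmd
  /-- append the set of all vertices `w` (register `5`) with the property `φ` -/
  | app (φ : Expr) : Cmd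
  /-- for every vertex `u` (register `4`) with the property `ψ`, append the set of all vertices `w`
  (register `5`) with the property `φ` -/
  | each (ψ φ : Expr) : Cmd
  | ite (e : Expr) (c d : Cmd) : Cmd
  | seq (c d : Cmd) : Cmd

namespace Cmd

/-- The sets that a command appends. -/
def sem {n : ℕ} : Cmd → State → List (Finset (Fin n))
  | nil, _ => []
  | app φ, s => [Finset.univ.filter fun w : Fin n => φ.Sat (s.setReg 5 w)]
  | each ψ φ, s => (List.finRange n).flatMap fun u : Fin n =>
      if ψ.Sat (s.setReg 4 u) then
        [Finset.univ.filter fun w : Fin n => φ.Sat ((s.setReg 4 u).setReg 5 w)]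
      else []
  | ite e c d, s => if e.Sat s then c.sem s else d.sem s
  | seq c d, s => c.sem s ++ d.sem s

/-- The expressions in the command use the registers below `12` only. -/
def WF : Cmd → Prop
  | nil => True
  | app φ => φ.WF 12
  | each ψ φ => ψ.WF 12 ∧ φ.WF 12
  | ite e c d => e.WF 12 ∧ c.WF ∧ d.WF
  | seq c d => c.WF ∧ d.WF

/-- The code of `Cmd.app`. -/
def appCode (φ : Expr) : Prog :=
  .seq (.copy 17 5) <| .seq (.const 5 0) <|
    -- The comparison with `0` turns an arbitrary positive value into the bit `1`, as the queue
    -- format demands.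
    .seq (.whileLt 5 0 <| .seq ((Expr.lt (.lit 0) φ).code 20) <| .seq (.store 2 15 20) <|
      .seq (.incr 15) (.incr 5)) <|
    .seq (.copy 5 17) (.incr 14)

/-- The code of a command. -/
def code : Cmd → Prog
  | nil => .skip
  | app φ => appCode φ
  | each ψ φ =>
    .seq (.copy 18 4) <| .seq (.const 4 0) <|
      .seq (.whileLt 4 0 <| .seq (ψ.code 20) <| .seq (.const 21 0) <|
        .seq (.ifLt 21 20 (appCode φ) .skip) (.incr 4)) (.copy 4 18)
  | ite e c d => .seq (e.code 20) <| .seq (.const 21 0) <| .ifLt 21 20 c.code d.code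
  | seq c d => .seq c.code d.code

/-- A bound for the running time of `Cmd.appCode`. -/
def appCost (φ : Expr) (n : ℕ) : ℕ := n * (φ.cost n + 7) + 5

/-- A bound for the running time of a command. -/
def cost : Cmd → ℕ → ℕ
  | nil, _ => 1
  | app φ, n => appCost φ n
  | each ψ φ, n => n * (ψ.cost n + appCost φ n + 4) + 4
  | ite e c d, n => e.cost n + c.cost n + d.cost n + 2
  | seq c d, n => c.cost n + d.cost n

theorem sem_congr {n : ℕ} {c : Cmd} (h : c.WF) {s s' : State} (hs : Frame s s') :
    c.sem (n := n) s' = c.sem s := by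
  induction c with
  | nil => rfl
  | app φ =>
    simp only [sem, List.cons.injEq, and_true]
    refine Finset.filter_congr fun w _ => Expr.sat_congr h (by norm_num) (fun x hx => ?_) hs.arr
    simp [hs.reg x (by omega) (by omega) (by omega)]
  | each ψ φ =>
    simp only [sem]
    congr 1
    funext u
    congr 1
    · refine propext (Expr.sat_congr h.1 (by norm_num) (fun x hx => ?_) hs.arr)
      simp [hs.reg x (by omega) (by omega) (by omega)]
    · simp only [List.cons.injEq, and_true]
      refine Finset.filter_congr fun w _ => Expr.sat_congr h.2 (by norm_num) (fun x hx => ?_) hs.arr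
      simp [hs.reg x (by omega) (by omega) (by omega)]
  | ite e c d ihc ihd =>
    simp only [sem, ihc h.2.1, ihd h.2.2]
    congr 1
    rw [Expr.sat_congr h.1 (by norm_num) (fun x hx => ?_) hs.arr]
    exact hs.reg x (by omega) (by omega) (by omega)
  | seq c d ihc ihd => simp only [sem, ihc h.1, ihd h.2]

/-- Register `18` is mentioned separately because `Cmd.each` keeps the saved content of register `4`
there, and `Frame` says nothing about registers from `17` on. -/
theorem reach_appCode {n : ℕ} {φ : Expr} (h : φ.WF 12) {q : List (Finset (Fin n))} {s : State}
    (hn : s.reg 0 = n) (hq : IsQueue q s) :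
    Reach (appCode φ) s (appCost φ n) fun s' => Frame s s' ∧
      s'.reg 18 = s.reg 18 ∧
      IsQueue (q ++ [Finset.univ.filter fun w : Fin n => φ.Sat (s.setReg 5 w)]) s' := by
  refine (Reach.copySeq <| Reach.constSeq <| Reach.seq
    (T := n * (φ.cost n + 6 + 1) + 1)
    (Reach.loop (T := φ.cost n + 6) (fun j s' =>
      (∀ x < 19, x ≠ 5 → x ≠ 15 → x ≠ 17 → s'.reg x = s.reg x) ∧ (∀ a, a ≠ 2 → s'.arr a = s.arr a) ∧
      s'.out = s.out ∧ s'.reg 17 = s.reg 5 ∧ s'.reg 5 = j ∧ s'.reg 15 = q.length * n + j ∧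
      (∀ x < q.length * n, s'.arr 2 x = s.arr 2 x) ∧
      ∀ w < j, s'.arr 2 (q.length * n + w) = if φ.Sat (s.setReg 5 w) then 1 else 0) n
      ?_ ?_ ?_) (T' := 2) ?_).mono (by simp [appCost]) fun _ => id
  · rintro j s' - ⟨h1, -, -, -, h2, -⟩
    rw [h1 0 (by simp) (by simp) (by simp) (by simp), h2, hn]
  · rintro j s' hj ⟨h1, h2, h3, h4, h5, h6, h7, h8⟩
    have hwf : (Expr.lt (.lit 0) φ).WF 12 := ⟨trivial, h⟩
    have h0 : s'.reg 0 = n := by rw [h1 0 (by simp) (by simp) (by simp) (by simp), hn]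
    refine (Reach.seq (Expr.reach_code _ (hwf.mono (by omega)) (by omega) s') (T' := 3) ?_).mono
      (by rw [Expr.cost, Expr.cost, h0]; omega) fun _ => id
    rintro s'' ⟨k1, k2, k3, k4⟩
    have hev : s''.reg 20 = if φ.Sat (s.setReg 5 j) then 1 else 0 := by
      rw [k4, Expr.eval_congr hwf (by simp) (s := s.setReg 5 j) (by simp; grind) (by simpa using h2)]
      rfl
    refine Reach.storeSeq <| Reach.incrSeq <| Reach.incr ?_
    have k15 := k1 15 (by omega)
    refine ⟨?_, ?_, ?_, ?_, ?_, ?_, ?_, ?_⟩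
    · intro x hx hx5 hx15 hx17
      simp [hx5, hx15, k1 x (by omega), h1 x hx hx5 hx15 hx17]
    · intro a ha
      funext x
      simp [ha, k2, h2]
    · simp [k3, h3]
    · simp [k1, h4]
    · simp [k1, h5]
    · simp [k15, h6, add_assoc]
    · intro x hx
      simp only [State.setReg_arr, State.setArr_arr, k15, h6]
      rw [if_neg (by omega), k2, h7 x hx]
    · intro w hw
      simp only [State.setReg_arr, State.setArr_arr, k15, h6, true_and]
      split_ifs with hwj
      · obtain rfl : w = j := by omega
        simpa [*] using hev
      · obtain rfl : w = j := by omega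
        simpa [*] using hev
      · rw [k2, h8 w (by omega), if_pos (by assumption)]
      · rw [k2, h8 w (by omega), if_neg (by assumption)]
  · refine ⟨?_, ?_, ?_, ?_, ?_, ?_, ?_, ?_⟩
    · intro x hx hx5 hx15 hx17
      simp [hx5, hx17]
    · simp
    · simp
    · simp
    · simp
    · simp [hq.addr]
    · simp
    · simp
  · rintro s' ⟨h1, h2, h3, h4, h5, h6, h7, h8⟩
    refine Reach.copySeq <| Reach.incr ⟨⟨?_, ?_, ?_⟩, ?_, ?_, ?_, ?_⟩
    · intro x hx hx14 hx15
      by_cases hx5 : x = 5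
      · subst hx5
        simp [h4]
      · simp [hx14, hx5, h1 x (by omega) hx5 hx15 hx.ne]
    · simpa using h2
    · simpa using h3
    · simp [h1]
    · simp [h1, hq.length]
    · simp [h6, add_mul]
    · intro j hj u
      have hu := u.2
      simp only [State.setReg_arr]
      rw [List.getElem_append]
      split_ifs with hlt hmem hmem
      · rw [h7 _ (by nlinarith), hq.mem j hlt, if_pos hmem]
      · rw [h7 _ (by nlinarith), hq.mem j hlt, if_neg hmem]
      · obtain rfl : j = q.length := by simp at hj; omega
        rw [h8 u hu, if_pos (by simpa using hmem)]
      · obtain rfl : j = q.length := by simp at hj; omega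
        rw [h8 u hu, if_neg (by simpa using hmem)]

theorem reach_code {n : ℕ} {c : Cmd} (h : c.WF) {q : List (Finset (Fin n))} {s : State}
    (hn : s.reg 0 = n) (hq : IsQueue q s) :
    Reach c.code s (c.cost n) fun s' => Frame s s' ∧ IsQueue (q ++ c.sem s) s' := by
  induction c generalizing q s with
  | nil => exact Reach.skip ⟨.refl s, by simpa [sem] using hq⟩
  | app φ => exact (reach_appCode h hn hq).mono le_rfl fun s' h => ⟨h.1, h.2.2⟩
  | each ψ φ =>
    refine (Reach.copySeq <| Reach.constSeq <| Reach.seq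
      (T := n * (ψ.cost n + appCost φ n + 3 + 1) + 1)
      (Reach.loop (T := ψ.cost n + appCost φ n + 3) (fun j s' =>
        (∀ x < 17, x ≠ 4 → x ≠ 14 → x ≠ 15 → s'.reg x = s.reg x) ∧
        (∀ a, a ≠ 2 → s'.arr a = s.arr a) ∧
        s'.out = s.out ∧ s'.reg 18 = s.reg 4 ∧ s'.reg 4 = j ∧
        IsQueue (q ++ ((List.finRange n).take j).flatMap fun u : Fin n =>
          if ψ.Sat (s.setReg 4 u) then
            [Finset.univ.filter fun w : Fin n => φ.Sat ((s.setReg 4 u).setReg 5 w)]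
          else []) s') n ?_ ?_ ?_) (T' := 1) ?_).mono (by simp [cost]) fun _ => id
    · rintro j s' - ⟨h1, -, -, -, h2, -⟩
      rw [h1 0 (by simp) (by simp) (by simp) (by simp), h2, hn]
    · rintro j s' hj ⟨h1, h2, h3, h4, h5, h6⟩
      have h0 : s'.reg 0 = n := by rw [h1 0 (by simp) (by simp) (by simp) (by simp), hn]
      refine (Reach.seq (Expr.reach_code ψ (h.1.mono (by omega)) (by omega) s')
        (T' := appCost φ n + 3) ?_).mono (by rw [h0]; omega) fun _ => id
      rintro s'' ⟨k1, k2, k3, k4⟩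
      rw [Expr.eval_congr h.1 (by simp) (s := s.setReg 4 j) (by simp; grind) (by simpa using h2)]
        at k4
      -- The vertices below `j + 1` are those below `j` followed by `j`, so one round appends
      -- exactly the contribution of `j`.
      rw [← List.take_concat_get' _ _ (by simpa using hj), List.flatMap_append,
        List.flatMap_singleton, List.getElem_finRange, ← List.append_assoc]
      have happ : 0 < appCost φ n := by rw [appCost]; omega
      set q' := q ++ ((List.finRange n).take j).flatMap fun u : Fin n =>
        if ψ.Sat (s.setReg 4 u) then
          [Finset.univ.filter fun w : Fin n => φ.Sat ((s.setReg 4 u).setReg 5 w)]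
        else []
      have hq' : IsQueue q' (s''.setReg 21 0) :=
        ⟨by simp [k1, h6.length], by simp [k1, h6.addr], by simpa [k2] using h6.mem⟩
      have hn' : (s''.setReg 21 0).reg 0 = n := by simp [k1, h0]
      simp only [Fin.val_cast]
      refine Reach.constSeq <| Reach.seq (T := appCost φ n + 1) (T' := 1)
        (Reach.ifLt (Q := fun s₁ =>
        Frame (s''.setReg 21 0) s₁ ∧ s₁.reg 18 = s.reg 4 ∧ IsQueue (q' ++
          if ψ.Sat (s.setReg 4 j) then
          [Finset.univ.filter fun w : Fin n => φ.Sat ((s.setReg 4 j).setReg 5 w)]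
          else []) s₁)
        (fun hlt => ?_) fun hlt => (Reach.skip ?_).mono happ fun _ => id) ?_
      · refine (reach_appCode h.2 hn' hq').mono le_rfl fun s₁ hs₁ => ⟨hs₁.1, ?_, ?_⟩
        · simp [hs₁.2.1, k1, h4]
        · rw [if_pos (by simpa [Expr.Sat, k4] using hlt)]
          convert hs₁.2.2 using 4
          refine (Expr.sat_congr h.2 (by simp) ?_ ?_).symm
          · simp
            grind
          · simpa [k2] using h2
      · rw [if_neg (by simpa [Expr.Sat, k4] using hlt), List.append_nil]
        exact ⟨.refl _, by simp [k1, h4], hq'⟩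
      · rintro s₁ ⟨l1, l2, l3⟩
        refine Reach.incr ⟨?_, ?_, ?_, ?_, ?_, ?_⟩
        · intro x hx hx4 hx14 hx15
          simp [hx4, l1.reg x hx hx14 hx15, k1 x (by omega), h1 x hx hx4 hx14 hx15]
          omega
        · intro a ha
          simp [l1.arr a ha, k2, h2 a ha]
        · simp [l1.out, k3, h3]
        · simp [l2]
        · simp [l1.reg 4, k1, h5]
        · exact ⟨l3.length, l3.addr, l3.mem⟩
    · refine ⟨?_, ?_, ?_, ?_, ?_, ?_⟩
      · intro x hx hx4 hx14 hx15
        simp [hx4]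
        omega
      · simp
      · simp
      · simp
      · simp
      · simpa using ⟨hq.length, hq.addr, hq.mem⟩
    · rintro s' ⟨h1, h2, h3, h4, h5, h6⟩
      refine Reach.copy ⟨⟨?_, ?_, ?_⟩, ?_⟩
      · intro x hx hx14 hx15
        by_cases hx4 : x = 4
        · subst hx4
          simp [h4]
        · simp [hx4, h1 x hx hx4 hx14 hx15]
      · simpa using h2
      · simpa using h3
      · rw [List.take_of_length_le (by simp)] at h6
        exact ⟨h6.length, h6.addr, h6.mem⟩
  | ite e c d ihc ihd =>
    refine (Reach.seq (Expr.reach_code e (h.1.mono (by omega)) (by omega) s)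
      (T' := c.cost n + d.cost n + 2) ?_).mono (by rw [hn, cost]; omega) fun _ => id
    rintro s' ⟨h1, h2, h3, h4⟩
    have hf : Frame s (s'.setReg 21 0) :=
      ⟨fun x hx _ _ => by simp [h1 x (by omega)]; omega, by simp [h2], by simp [h3]⟩
    have hq' : IsQueue q (s'.setReg 21 0) :=
      ⟨by simp [h1, hq.length], by simp [h1, hq.addr], by simpa [h2] using hq.mem⟩
    have hn' : (s'.setReg 21 0).reg 0 = n := by simp [h1, hn]
    refine Reach.constSeq <| Reach.ifLt (fun hlt => (ihc h.2.1 hn' hq').mono (by omega) ?_)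
      fun hlt => (ihd h.2.2 hn' hq').mono (by omega) ?_
    · rw [sem, if_pos (by simpa [Expr.Sat, h4] using hlt), sem_congr h.2.1 hf]
      exact fun s'' h => ⟨hf.trans h.1, h.2⟩
    · rw [sem, if_neg (by simpa [Expr.Sat, h4] using hlt), sem_congr h.2.2 hf]
      exact fun s'' h => ⟨hf.trans h.1, h.2⟩
  | seq c d ihc ihd =>
    refine Reach.seq (ihc h.1 hn hq) ?_
    rintro s' ⟨h1, h2⟩
    refine (ihd h.2 (by rw [h1.reg 0 (by simp) (by simp) (by simp), hn]) h2).mono le_rfl ?_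
    rw [sem_congr h.2 h1, List.append_assoc]
    exact fun s'' h => ⟨h1.trans h.1, h.2⟩

end Cmd

end AlmostClosed

namespace AlmostClosed

variable {n : ℕ}

/-! ### Processing the queue level by level -/

/-- Load the head block of the queue into the array `3` and move the head. -/
def dequeue : Prog :=
  .seq (.const 19 0) <|
    .seq (.whileLt 19 0 <| .seq (.load 18 2 13) <| .seq (.store 3 19 18) <|
      .seq (.incr 13) (.incr 19)) (.incr 12)

theorem reach_dequeue {q : List (Finset (Fin n))} {s : State} {h : ℕ} (hn : s.reg 0 = n)
    (hq : IsQueue q s) (hh : h < q.length) (h12 : s.reg 12 = h) (h13 : s.reg 13 = h * n) :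
    Reach dequeue s (n * 5 + 3) fun s' =>
      (∀ x < 18, x ≠ 12 → x ≠ 13 → s'.reg x = s.reg x) ∧ s'.reg 12 = h + 1 ∧
      s'.reg 13 = (h + 1) * n ∧ (∀ a, a ≠ 3 → s'.arr a = s.arr a) ∧ s'.out = s.out ∧
      IsCurrent q[h] s' := by
  refine (Reach.constSeq <| Reach.seq (T' := 1) (Reach.loop (T := 4) (fun j s' =>
    (∀ x < 18, x ≠ 13 → s'.reg x = s.reg x) ∧ s'.reg 13 = h * n + j ∧ s'.reg 19 = j ∧
      (∀ a, a ≠ 3 → s'.arr a = s.arr a) ∧ s'.out = s.out ∧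
      ∀ w < j, s'.arr 3 w = s.arr 2 (h * n + w)) n ?_ ?_ ?_) ?_).mono (by omega) fun _ => id
  · rintro j s' - ⟨h1, -, h2, -⟩
    rw [h1 0 (by simp) (by simp), h2, hn]
  · rintro j s' hj ⟨h1, h2, h3, h4, h5, h6⟩
    refine Reach.loadSeq <| Reach.storeSeq <| Reach.incrSeq <| Reach.incr ⟨?_, ?_, ?_, ?_, ?_, ?_⟩
    · intro x hx hx13
      simp [hx13, h1 x hx hx13, show x ≠ 18 by omega, show x ≠ 19 by omega]
    · simp [h2, add_assoc]
    · simp [h3]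
    · intro a ha
      funext x
      simp [ha, h4]
    · simp [h5]
    · intro w hw
      by_cases hwj : w = j
      · subst hwj
        simp [h3, h2, h4]
      · simp [h3, hwj, h6 w (by omega)]
  · simp [h13]
    omega
  · rintro s' ⟨h1, h2, h3, h4, h5, h6⟩
    refine Reach.incr ⟨?_, ?_, ?_, ?_, ?_, ?_⟩
    · intro x hx hx12 hx13
      simp [hx12, h1 x hx hx13]
    · simp [h1, h12]
    · simp [h2, add_mul]
    · simpa using h4
    · simpa using h5
    · intro u
      simp [h6 u u.2, hq.mem h hh u]

/-- The two states agree on the input, the output, and all registers below `12` except the level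
counter `2`. -/
structure Vis (s s' : State) : Prop where
  reg : ∀ x < 12, x ≠ 2 → s'.reg x = s.reg x
  arr : ∀ a, a ≠ 2 → a ≠ 3 → s'.arr a = s.arr a
  out : s'.out = s.out

theorem Vis.trans {s s' s'' : State} (h : Vis s s') (h' : Vis s' s'') : Vis s s'' :=
  ⟨fun x a b => (h'.reg x a b).trans (h.reg x a b),
    fun a h2 h3 => (h'.arr a h2 h3).trans (h.arr a h2 h3), h'.out.trans h.out⟩

/-- The part of the queue from the head on is `L`. -/
def Pending (L : List (Finset (Fin n))) (s : State) : Prop :=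
  ∃ q : List (Finset (Fin n)), IsQueue (q ++ L) s ∧ s.reg 12 = q.length ∧ s.reg 13 = q.length * n

/-- Replace every pending set by the sets that the command `c` appends for it. -/
def levelCode (c : Cmd) : Prog :=
  -- Register `16` freezes the end of the current level: blocks appended during the loop belong to
  -- the next level.
  .seq (.copy 16 14) <| .whileLt 12 16 <| .seq dequeue c.code

/-- Consumed blocks are never overwritten. The head passes over the old level while its children
accumulate behind it, so the part from the head on ends up as the next level. -/
theorem reach_levelCode {c : Cmd} (hc : c.WF) {L : List (Finset (Fin n))} {s : State}
    (hn : s.reg 0 = n) (hL : Pending L s) (step : Finset (Fin n) → List (Finset (Fin n)))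
    (hstep : ∀ K s', Vis s s' → s'.reg 2 = s.reg 2 → IsCurrent K s' → c.sem s' = step K) :
    Reach (levelCode c) s (L.length * (n * 5 + c.cost n + 4) + 2) fun s' =>
      Vis s s' ∧ s'.reg 2 = s.reg 2 ∧ Pending (L.flatMap step) s' := by
  obtain ⟨q, hq, h12, h13⟩ := hL
  refine (Reach.copySeq <| (Reach.loop (T := n * 5 + c.cost n + 3) (fun j s' =>
    Vis s s' ∧ s'.reg 2 = s.reg 2 ∧ IsQueue (q ++ L ++ (L.take j).flatMap step) s' ∧
    s'.reg 12 = q.length + j ∧ s'.reg 13 = (q.length + j) * n ∧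
    s'.reg 16 = q.length + L.length) L.length ?_ ?_ ?_).mono le_rfl ?_)
  · rintro j s' - ⟨-, -, -, h1, -, h2⟩
    rw [h1, h2]
    omega
  · rintro j s' hj ⟨h1, h2, h3, h4, h5, h6⟩
    have h0 : s'.reg 0 = n := by rw [h1.reg 0 (by simp) (by simp), hn]
    have hlt : q.length + j < (q ++ L ++ (L.take j).flatMap step).length := by simp; omega
    refine (Reach.seq (reach_dequeue h0 h3 hlt h4 h5) (T' := c.cost n) ?_).mono (by omega)
      fun _ => id
    rintro s'' ⟨k1, k2, k3, k4, k5, k6⟩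
    -- Appending children does not move the blocks of the current level.
    have hget : (q ++ L ++ (L.take j).flatMap step)[q.length + j] = L[j] := by
      rw [List.getElem_append_left (by simpa using hj), List.getElem_append_right (by omega)]
      simp
    rw [hget] at k6
    have hv : Vis s s'' := h1.trans ⟨fun x hx _ => k1 x (by omega) (by omega) (by omega),
      fun a _ h => k4 a h, k5⟩
    have hv2 : s''.reg 2 = s.reg 2 := by rw [k1 2 (by simp) (by simp) (by simp), h2]
    have hq' : IsQueue (q ++ L ++ (L.take j).flatMap step) s'' :=
      ⟨by rw [k1 14 (by simp) (by simp) (by simp), h3.length],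
        by rw [k1 15 (by simp) (by simp) (by simp), h3.addr], by
        rw [k4 2 (by simp)]
        exact h3.mem⟩
    have h0' : s''.reg 0 = n := by rw [hv.reg 0 (by simp) (by simp), hn]
    refine (Cmd.reach_code hc h0' hq').mono le_rfl ?_
    rintro s₁ ⟨l1, l2⟩
    rw [hstep _ _ hv hv2 k6, List.append_assoc, ← List.flatMap_singleton step L[j],
      ← List.flatMap_append, List.take_concat_get' _ _ hj] at l2
    refine ⟨hv.trans ⟨fun x hx _ => l1.reg x (by omega) (by omega) (by omega),
      fun a h _ => l1.arr a h, l1.out⟩, ?_, l2, ?_, ?_, ?_⟩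
    · rw [l1.reg 2 (by simp) (by simp) (by simp), hv2]
    · rw [l1.reg 12 (by simp) (by simp) (by simp), k2, add_assoc]
    · rw [l1.reg 13 (by simp) (by simp) (by simp), k3, add_assoc]
    · rw [l1.reg 16 (by simp) (by simp) (by simp), k1 16 (by simp) (by simp) (by simp), h6]
  · refine ⟨⟨fun x hx _ => ?_, fun _ _ _ => rfl, rfl⟩, ?_, ?_, ?_, ?_, ?_⟩
    · simp
      omega
    · simp
    · simpa using ⟨hq.length, hq.addr, hq.mem⟩
    · simp [h12]
    · simp [h13]
    · simp [hq.length]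
  · rintro s' ⟨h1, h2, h3, h4, h5, h6⟩
    refine ⟨h1, h2, q ++ L, by simpa using h3, by simpa using h4, by simpa using h5⟩

/-- The list of sets after `j` levels. -/
def levels (step : ℕ → Finset (Fin n) → List (Finset (Fin n))) (L : List (Finset (Fin n))) :
    ℕ → List (Finset (Fin n))
  | 0 => L
  | j + 1 => (levels step L j).flatMap (step j)

/-- Process as many levels as the register `b` says. The number of the level is in the
register `2`. -/
def roundsCode (b : ℕ) (c : Cmd) : Prog :=
  .seq (.const 2 0) <| .whileLt 2 b <| .seq (levelCode c) (.incr 2)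

/-- The bound `B` is needed only for levels that are expanded; the last level is charged to the code
that reads it. -/
theorem reach_roundsCode {b : ℕ} (hb : b < 12) (hb2 : b ≠ 2) {c : Cmd} (hc : c.WF)
    {L : List (Finset (Fin n))} {s : State} (hn : s.reg 0 = n) (hL : Pending L s)
    (step : ℕ → Finset (Fin n) → List (Finset (Fin n))) {B : ℕ}
    (hstep : ∀ v < s.reg b, ∀ K s', Vis s s' → s'.reg 2 = v → IsCurrent K s' →
      c.sem s' = step v K)
    (hB : ∀ v < s.reg b, (levels step L v).length ≤ B) :
    Reach (roundsCode b c) s (s.reg b * (B * (n * 5 + c.cost n + 4) + 4) + 2) fun s' =>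
      Vis s s' ∧ Pending (levels step L (s.reg b)) s' := by
  refine Reach.constSeq <| (Reach.loop (T := B * (n * 5 + c.cost n + 4) + 3) (fun j s' =>
    Vis s s' ∧ s'.reg 2 = j ∧ Pending (levels step L j) s') (s.reg b) ?_ ?_ ?_).mono le_rfl ?_
  · rintro j s' - ⟨h1, h2, -⟩
    rw [h1.reg b hb hb2, h2]
  · rintro j s' hj ⟨h1, h2, h3⟩
    have h0 : s'.reg 0 = n := by rw [h1.reg 0 (by simp) (by simp), hn]
    refine (Reach.seq (reach_levelCode hc h0 h3 (step j) fun K s'' hv hv2 hK =>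
      hstep j hj K s'' (h1.trans hv) (hv2.trans h2) hK) (T' := 1) ?_).mono ?_ fun _ => id
    · rintro s'' ⟨k1, k2, q, hq, k3, k4⟩
      refine Reach.incr ⟨h1.trans (k1.trans ⟨?_, fun _ _ _ => rfl, rfl⟩), ?_, q, ?_, ?_, ?_⟩
      · intro x _ hx
        simp [hx]
      · simp [k2, h2]
      · exact ⟨hq.length, hq.addr, hq.mem⟩
      · simpa using k3
      · simpa using k4
    · have := Nat.mul_le_mul_right (n * 5 + c.cost n + 4) (hB j hj)
      omega
  · obtain ⟨q, hq, h3, h4⟩ := hL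
    refine ⟨⟨?_, fun _ _ _ => rfl, rfl⟩, ?_, q, ⟨hq.length, hq.addr, hq.mem⟩, ?_, ?_⟩
    · intro x _ hx
      simp [hx]
    · simp
    · simpa using h3
    · simpa using h4
  · exact fun s' h => ⟨h.1, h.2.2⟩

/-- Put the empty set into the queue. -/
def initCode : Prog := .seq (.copy 15 0) (.const 14 1)

/-- A block of `n` zeros is the empty set, so on a cleared array only the length and the end address
of the queue have to be set. -/
theorem reach_initCode {s : State} (hn : s.reg 0 = n) (h12 : s.reg 12 = 0) (h13 : s.reg 13 = 0)
    (h2 : ∀ i, s.arr 2 i = 0) :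
    Reach initCode s 2 fun s' => (∀ x, x ≠ 14 → x ≠ 15 → s'.reg x = s.reg x) ∧ s'.arr = s.arr ∧
      s'.out = s.out ∧ Pending [(∅ : Finset (Fin n))] s' := by
  refine Reach.copySeq <| Reach.const ⟨?_, rfl, rfl, [], ⟨?_, ?_, ?_⟩, ?_, ?_⟩
  · intro x h h'
    simp [h, h']
  · simp
  · simp [hn]
  · intro j hj u
    obtain rfl : j = 0 := by simpa using hj
    simp [h2]
  · simpa using h12
  · simpa using h13

/-! ### Writing the pending sets -/

/-- Write the code words of the pending sets. -/
def emitCode : Prog :=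
  .seq (.const 17 0) <| .whileLt 12 14 <| .seq (.const 19 0) <|
    -- The counter is increased before it is emitted, which produces the code `v + 1` of the vertex
    -- `v`; register `17` holds `0`, both for testing the bit and as the end marker.
    .seq (.whileLt 19 0 <| .seq (.load 18 2 13) <| .seq (.incr 13) <| .seq (.incr 19) <|
      .ifLt 17 18 (.emit 19) .skip) <| .seq (.emit 17) (.incr 12)

/-- Scanning the bits of a block from left to right yields the sorted list that `encodeSet` asks
for. -/
theorem sort_eq_filter_finRange (K : Finset (Fin n)) :
    K.sort (· ≤ ·) = (List.finRange n).filter (· ∈ K) := by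
  refine List.Perm.eq_of_pairwise' (r := (· ≤ ·)) (Finset.pairwise_sort K (· ≤ ·)) ?_ ?_
  · exact (List.pairwise_le_finRange n).filter _
  · refine (List.perm_ext_iff_of_nodup (Finset.sort_nodup K (· ≤ ·))
      ((List.nodup_finRange n).filter _)).2 fun a => ?_
    simp

theorem reach_emitCode {L : List (Finset (Fin n))} {s : State} (hn : s.reg 0 = n)
    (hL : Pending L s) :
    Reach emitCode s (L.length * (n * 6 + 5) + 2) fun s' =>
      s'.out = s.out ++ L.flatMap encodeSet := by
  obtain ⟨q, hq, h12, h13⟩ := hL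
  refine (Reach.constSeq <| (Reach.loop (T := n * 6 + 4) (fun j s' =>
    s'.reg 0 = n ∧ s'.reg 17 = 0 ∧ s'.reg 14 = q.length + L.length ∧ s'.arr = s.arr ∧
    s'.reg 12 = q.length + j ∧ s'.reg 13 = (q.length + j) * n ∧
    s'.out = s.out ++ (L.take j).flatMap encodeSet) L.length ?_ ?_ ?_).mono le_rfl ?_)
  · rintro j s' - ⟨-, -, h1, -, h2, -⟩
    rw [h1, h2]
    omega
  · rintro j s' hj ⟨h1, h2, h3, h4, h5, h6, h7⟩
    refine Reach.constSeq <| (Reach.seq (T' := 2) (Reach.loop (T := 5) (fun i s' =>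
      s'.reg 0 = n ∧ s'.reg 17 = 0 ∧ s'.reg 14 = q.length + L.length ∧ s'.arr = s.arr ∧
      s'.reg 12 = q.length + j ∧ s'.reg 13 = (q.length + j) * n + i ∧ s'.reg 19 = i ∧
      s'.out = s.out ++ (L.take j).flatMap encodeSet ++
        (((List.finRange n).take i).filter (· ∈ L[j])).map fun v => v.val + 1)
      n ?_ ?_ ?_) ?_).mono (by omega) fun _ => id
    · rintro i s'' - ⟨h1, -, -, -, -, -, h2, -⟩
      rw [h1, h2]
    · rintro i s'' hi ⟨k1, k2, k3, k4, k5, k6, k7, k8⟩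
      have hbit := hq.mem (q.length + j) (by simpa using hj) ⟨i, hi⟩
      rw [List.getElem_append_right (by omega)] at hbit
      simp only [Nat.add_sub_cancel_left] at hbit
      rw [← List.take_concat_get' _ _ (by simpa using hi), List.filter_append,
        List.map_append, ← List.append_assoc, List.getElem_finRange]
      refine Reach.loadSeq <| Reach.incrSeq <| Reach.incrSeq <|
        Reach.ifLt (T := 1) (fun hlt => Reach.emit ?_) fun hlt => Reach.skip ?_
      · have hmem : (⟨i, hi⟩ : Fin n) ∈ L[j] := by
          by_contra h
          simp [k6, k4, k2, hbit, h] at hlt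
        simp [k1, k2, k3, k4, k5, k6, k7, k8, add_assoc, hmem]
      · have hmem : (⟨i, hi⟩ : Fin n) ∉ L[j] := by
          intro h
          simp [k6, k4, k2, hbit, h] at hlt
        simp [k1, k2, k3, k4, k5, k6, k7, k8, add_assoc, hmem]
    · simp [h1, h2, h3, h4, h5, h6, h7]
    · rintro s'' ⟨k1, k2, k3, k4, k5, k6, k7, k8⟩
      rw [List.take_of_length_le (l := List.finRange n) (by simp)] at k8
      refine (Reach.seq (Reach.emit (Q := (· = s''.emit (s''.reg 17))) rfl) (T' := 1) ?_).mono
        le_rfl fun _ => id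
      rintro _ rfl
      refine Reach.incr ⟨?_, ?_, ?_, ?_, ?_, ?_, ?_⟩
      · simpa using k1
      · simpa using k2
      · simpa using k3
      · simpa using k4
      · simp [k5, add_assoc]
      · simp [k6]
        ring
      · rw [← List.take_concat_get' _ _ hj, List.flatMap_append, List.flatMap_singleton]
        simp [k8, k2, encodeSet, sort_eq_filter_finRange]
  · refine ⟨?_, ?_, ?_, ?_, ?_, ?_, ?_⟩
    · simpa using hn
    · simp
    · simp [hq.length]
    · simp
    · simp [h12]
    · simp [h13]
    · simp
  · rintro s' ⟨-, -, -, -, -, -, h⟩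
    simpa using h

/-! ### Testing the pending sets -/

/-- Write `1` if some pending set satisfies the formula `e`, and `0` otherwise. -/
def testCode (e : Expr) : Prog :=
  .seq (.const 17 0) <| .seq (.whileLt 12 14 <| .seq dequeue <| .seq (e.code 20) <|
    .seq (.const 21 0) <| .ifLt 21 20 (.const 17 1) .skip) (.emit 17)

open Classical in
theorem reach_testCode {e : Expr} (he : e.WF 12) {L : List (Finset (Fin n))} {s : State}
    (hn : s.reg 0 = n) (hL : Pending L s) (p : Finset (Fin n) → Prop)
    (hp : ∀ K s', Vis s s' → IsCurrent K s' → (e.Sat s' ↔ p K)) :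
    Reach (testCode e) s (L.length * (n * 5 + e.cost n + 7) + 3) fun s' =>
      s'.out = s.out ++ [if ∃ K ∈ L, p K then 1 else 0] := by
  obtain ⟨q, hq, h12, h13⟩ := hL
  refine (Reach.constSeq <| Reach.seq (Reach.loop (T := n * 5 + e.cost n + 6) (fun j s' =>
    Vis s s' ∧ IsQueue (q ++ L) s' ∧ s'.reg 12 = q.length + j ∧ s'.reg 13 = (q.length + j) * n ∧
    s'.reg 17 = if ∃ K ∈ L.take j, p K then 1 else 0) L.length ?_ ?_ ?_) (T' := 1) ?_).mono
    le_rfl fun _ => id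
  · rintro j s' - ⟨-, h1, h2, -⟩
    rw [h1.length, h2, List.length_append]
    omega
  · rintro j s' hj ⟨h1, h2, h3, h4, h5⟩
    have h0 : s'.reg 0 = n := by rw [h1.reg 0 (by simp) (by simp), hn]
    have hlt : q.length + j < (q ++ L).length := by simp; omega
    refine (Reach.seq (reach_dequeue h0 h2 hlt h3 h4) (T' := e.cost n + 3) ?_).mono (by omega)
      fun _ => id
    rintro s'' ⟨k1, k2, k3, k4, k5, k6⟩
    rw [List.getElem_append_right (by omega)] at k6
    simp only [Nat.add_sub_cancel_left] at k6
    have hv : Vis s s'' := h1.trans ⟨fun x hx _ => k1 x (by omega) (by omega) (by omega),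
      fun a _ h => k4 a h, k5⟩
    have h0' : s''.reg 0 = n := by rw [hv.reg 0 (by simp) (by simp), hn]
    refine (Reach.seq (Expr.reach_code e (he.mono (by omega)) (by omega) s'') (T' := 3) ?_).mono
      (by rw [h0']) fun _ => id
    rintro s₁ ⟨l1, l2, l3, l4⟩
    have hv' : Vis s s₁ := hv.trans ⟨fun x hx _ => l1 x (by omega), fun a _ _ => by rw [l2], l3⟩
    have hq' : IsQueue (q ++ L) s₁ := by
      refine ⟨?_, ?_, ?_⟩
      · rw [l1 14 (by simp), k1 14 (by simp) (by simp) (by simp), h2.length]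
      · rw [l1 15 (by simp), k1 15 (by simp) (by simp) (by simp), h2.addr]
      · rw [l2, k4 2 (by simp)]
        exact h2.mem
    have h17 : s₁.reg 17 = if ∃ K ∈ L.take j, p K then 1 else 0 := by
      rw [l1 17 (by simp), k1 17 (by simp) (by simp) (by simp), h5]
    have hmem : (∃ K ∈ L.take (j + 1), p K) ↔ (∃ K ∈ L.take j, p K) ∨ p L[j] := by
      rw [← List.take_concat_get' _ _ hj]
      simp only [List.mem_append, List.mem_singleton, or_and_right, exists_or, exists_eq_left]
    have hsat := hp _ _ hv k6
    rw [Expr.Sat, ← l4] at hsat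
    refine Reach.constSeq <| Reach.ifLt (T := 1) (fun hlt => Reach.const ?_) fun hlt =>
      Reach.skip ?_
    · refine ⟨hv'.trans ⟨?_, fun _ _ _ => rfl, rfl⟩, ⟨?_, ?_, ?_⟩, ?_, ?_, ?_⟩
      · intro x hx _
        simp [show x ≠ 17 by omega, show x ≠ 21 by omega]
      · simpa using hq'.length
      · simpa using hq'.addr
      · exact hq'.mem
      · simp [l1, k2, add_assoc]
      · simp [l1, k3, add_assoc]
      · rw [if_pos (hmem.2 (.inr (hsat.1 (by simpa using hlt))))]
        simp
    · refine ⟨hv'.trans ⟨?_, fun _ _ _ => rfl, rfl⟩, ⟨?_, ?_, ?_⟩, ?_, ?_, ?_⟩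
      · intro x hx _
        simp
        omega
      · simpa using hq'.length
      · simpa using hq'.addr
      · exact hq'.mem
      · simp [l1, k2, add_assoc]
      · simp [l1, k3, add_assoc]
      · have : ¬ p L[j] := fun h => hlt (by simpa using hsat.2 h)
        simp only [hmem, this, or_false]
        simpa using h17
  · refine ⟨⟨?_, fun _ _ _ => rfl, rfl⟩, ⟨?_, ?_, ?_⟩, ?_, ?_, ?_⟩
    · intro x hx _
      simp
      omega
    · simpa using hq.length
    · simpa using hq.addr
    · exact hq.mem
    · simpa using h12
    · simpa using h13
    · simp
  · rintro s' ⟨h1, -, -, -, h2⟩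
    refine Reach.emit ?_
    simp [h2, h1.out]

end AlmostClosed

/-! ### Combinatorial bounds for maximal cliques -/

namespace AlmostClosed

-- Transfers closedness from the subtype of vertices outside `S` to a count in the whole vertex set.
open Classical in
theorem IsCClosed.card_lt {n : ℕ} {G : SimpleGraph (Fin n)} {S : Finset (Fin n)} {c : ℕ}
    (h : IsCClosed (deleteVerts G S) c) {u v : Fin n} (hu : u ∉ S) (hv : v ∉ S) (huv : u ≠ v)
    (hadj : ¬ G.Adj u v) :
    (Finset.univ.filter fun w => w ∉ S ∧ G.Adj u w ∧ G.Adj v w).card < c := by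
  refine lt_of_eq_of_lt ?_
    (h ⟨u, by simpa using hu⟩ ⟨v, by simpa using hv⟩ (by simpa using huv) (by simpa using hadj))
  rw [← Set.ncard_image_of_injective _ Subtype.val_injective, ← Set.ncard_coe_finset]
  congr 1
  ext w
  simp [SimpleGraph.mem_commonNeighbors]
  tauto

/-! ### The number of maximal cliques -/

section MaxCliques

variable {V : Type*} (G : SimpleGraph V)

open Classical in
/-- The maximal cliques of the subgraph induced by `W`. -/
noncomputable def maxCliques (W : Finset V) : Finset (Finset V) :=
  W.powerset.filter fun K => G.IsClique (K : Set V) ∧ ∀ u ∈ W, u ∉ K → ∃ w ∈ K, ¬ G.Adj u w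

variable {G}

theorem mem_maxCliques {W K : Finset V} : K ∈ maxCliques G W ↔
    K ⊆ W ∧ G.IsClique (K : Set V) ∧ ∀ u ∈ W, u ∉ K → ∃ w ∈ K, ¬ G.Adj u w := by
  simp [maxCliques]

theorem isClique_subset {K L : Finset V} (h : G.IsClique (L : Set V)) (hK : K ⊆ L) :
    G.IsClique (K : Set V) := h.subset (by exact_mod_cast hK)

/-- After cubing this is `m ^ 3 ≤ 3 ^ m`, with equality at `m = 3`; that is where the base of the
Moon–Moser bound comes from. -/
theorem natCast_le_three_rpow (m : ℕ) : (m : ℝ) ≤ (3 : ℝ) ^ ((m : ℝ) / 3) := by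
  have h : ∀ m : ℕ, m ^ 3 ≤ 3 ^ m := by
    intro m
    rcases lt_or_ge m 3 with hm | hm
    · interval_cases m <;> norm_num
    · induction m, hm using Nat.le_induction with
      | base => norm_num
      | succ m hm ih =>
        rw [pow_succ 3 m]
        nlinarith [Nat.mul_le_mul hm hm, Nat.mul_le_mul (Nat.mul_le_mul hm hm) hm]
  have h3 : ((3 : ℝ) ^ ((m : ℝ) / 3)) ^ 3 = 3 ^ m := by
    rw [← Real.rpow_natCast ((3 : ℝ) ^ ((m : ℝ) / 3)), ← Real.rpow_mul (by norm_num),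
      ← Real.rpow_natCast]
    congr 1
    push_cast
    ring
  refine le_of_pow_le_pow_left₀ (n := 3) (by norm_num) (by positivity) ?_
  rw [h3]
  exact_mod_cast h m

variable [DecidableEq V]

-- Let `v` have the fewest nonneighbors, itself included, say `d`. Every maximal clique contains one
-- of them: `v` itself or a witness that `v` cannot be added. The maximal cliques through a fixed
-- `u` inject into those of the neighborhood of `u`, which has at most `m - d` vertices. Induction
-- gives `d * 3 ^ ((m - d) / 3)`, and `d ≤ 3 ^ (d / 3)`.
open Classical in
theorem card_maxCliques_le (W : Finset V) :
    ((maxCliques G W).card : ℝ) ≤ (3 : ℝ) ^ ((W.card : ℝ) / 3) := by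
  induction hm : W.card using Nat.strong_induction_on generalizing W with
  | _ m ih =>
    rcases W.eq_empty_or_nonempty with rfl | hW
    · have : (maxCliques G (∅ : Finset V)).card ≤ 1 := by
        refine (Finset.card_le_card (t := {∅}) fun K hK => ?_).trans (by simp)
        simpa using (mem_maxCliques.1 hK).1
      calc ((maxCliques G (∅ : Finset V)).card : ℝ) ≤ 1 := by exact_mod_cast this
        _ ≤ _ := Real.one_le_rpow (by norm_num) (by positivity)
    · let D : V → Finset V := fun x => W.filter fun y => ¬ G.Adj x y
      obtain ⟨v, hv, hmin⟩ := Finset.exists_min_image W (fun x => (D x).card) hW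
      have hsub : maxCliques G W ⊆
          (D v).biUnion fun u => (maxCliques G W).filter fun K => u ∈ K := by
        intro K hK
        obtain ⟨h1, h2, h3⟩ := mem_maxCliques.1 hK
        by_cases hvK : v ∈ K
        · exact Finset.mem_biUnion.2 ⟨v, by simp [D, hv], by simp [hK, hvK]⟩
        · obtain ⟨w, hw, hvw⟩ := h3 v hv hvK
          exact Finset.mem_biUnion.2 ⟨w, by simp [D, h1 hw, hvw], by simp [hK, hw]⟩
      have hDv : 0 < (D v).card := Finset.card_pos.2 ⟨v, by simp [D, hv]⟩
      have hDle : ∀ x, (D x).card ≤ m := fun x => hm ▸ Finset.card_filter_le _ _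
      have hpart : ∀ u ∈ D v, (((maxCliques G W).filter fun K => u ∈ K).card : ℝ) ≤
          (3 : ℝ) ^ (((m : ℝ) - (D v).card) / 3) := by
        intro u hu
        have huW : u ∈ W := (Finset.mem_filter.1 hu).1
        have hle : ((maxCliques G W).filter fun K => u ∈ K).card ≤
            (maxCliques G (W \ D u)).card := by
          refine Finset.card_le_card_of_injOn (fun K => K.erase u) ?_ ?_
          · intro K hK
            obtain ⟨hK, huK⟩ := Finset.mem_filter.1 hK
            obtain ⟨h1, h2, h3⟩ := mem_maxCliques.1 hK
            refine mem_maxCliques.2 ⟨?_, isClique_subset h2 (Finset.erase_subset _ _), ?_⟩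
            · intro x hx
              have hx' := Finset.mem_erase.1 hx
              have := h2 huK hx'.2 hx'.1.symm
              simp [D, h1 hx'.2, this]
            · intro x hx hxK
              simp only [D, Finset.mem_sdiff, Finset.mem_filter, not_and, not_not] at hx
              have hux := hx.2 hx.1
              obtain ⟨w, hw, hxw⟩ := h3 x hx.1 fun h =>
                hxK (Finset.mem_erase.2 ⟨hux.ne', h⟩)
              exact ⟨w, Finset.mem_erase.2 ⟨fun h => hxw (h ▸ hux.symm), hw⟩, hxw⟩
          · intro K hK L hL h
            rw [← Finset.insert_erase (Finset.mem_filter.1 hK).2,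
              ← Finset.insert_erase (Finset.mem_filter.1 hL).2]
            exact congrArg _ h
        have hDu : 0 < (D u).card := Finset.card_pos.2 ⟨u, by simp [D, huW]⟩
        have hcard : (W \ D u).card = m - (D u).card := by
          rw [Finset.card_sdiff_of_subset (Finset.filter_subset _ _), hm]
        have := ih (m - (D u).card) (by have := hDle u; omega) (W \ D u) hcard
        refine (Nat.cast_le.2 hle).trans (this.trans ?_)
        refine Real.rpow_le_rpow_of_exponent_le (by norm_num) ?_
        rw [Nat.cast_sub (hDle u)]
        have : ((D v).card : ℝ) ≤ (D u).card := by exact_mod_cast hmin u huW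
        linarith
      calc ((maxCliques G W).card : ℝ)
          ≤ ((∑ u ∈ D v, ((maxCliques G W).filter fun K => u ∈ K).card : ℕ) : ℝ) := by
            exact_mod_cast (Finset.card_le_card hsub).trans Finset.card_biUnion_le
        _ ≤ ∑ u ∈ D v, (3 : ℝ) ^ (((m : ℝ) - (D v).card) / 3) := by
            rw [Nat.cast_sum]
            exact Finset.sum_le_sum hpart
        _ = (D v).card * (3 : ℝ) ^ (((m : ℝ) - (D v).card) / 3) := by simp
        _ ≤ (3 : ℝ) ^ (((D v).card : ℝ) / 3) * (3 : ℝ) ^ (((m : ℝ) - (D v).card) / 3) := by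
            gcongr
            exact natCast_le_three_rpow _
        _ = (3 : ℝ) ^ ((m : ℝ) / 3) := by
            rw [← Real.rpow_add (by norm_num)]
            congr 1
            ring

-- Induction on the vertices. Cliques `K` for which `K - v` is maximal in `W` are charged to `K -
-- v`. For every other `K`, some nonneighbor `u` of `v` in `W` is adjacent to all of `K - v`; then
-- `K - v` is a maximal clique of the common neighborhood of `u` and `v`, which has fewer than `c`
-- vertices, and Moon–Moser applies there.
open Classical in
theorem card_maxCliques_le_of_closed {c : ℕ} (W : Finset V)
    (hW : ∀ u ∈ W, ∀ v ∈ W, u ≠ v → ¬ G.Adj u v →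
      (W.filter fun w => G.Adj u w ∧ G.Adj v w).card < c) :
    ((maxCliques G W).card : ℝ) ≤ (1 + (W.card : ℝ) ^ 2) * (3 : ℝ) ^ ((c : ℝ) / 3) := by
  have hone : (1 : ℝ) ≤ (3 : ℝ) ^ ((c : ℝ) / 3) := Real.one_le_rpow (by norm_num) (by positivity)
  induction W using Finset.induction_on with
  | empty =>
    have := card_maxCliques_le (G := G) (∅ : Finset V)
    simp only [Finset.card_empty, Nat.cast_zero, zero_div, Real.rpow_zero] at this ⊢
    nlinarith
  | insert v W hv ih =>
    have ih := ih fun u hu w hw huw hadj => (Finset.card_le_card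
      (Finset.filter_subset_filter _ (Finset.subset_insert v W))).trans_lt
      (hW u (Finset.mem_insert_of_mem hu) w (Finset.mem_insert_of_mem hw) huw hadj)
    set M := maxCliques G (insert v W) with hM
    have h1 : (M.filter fun K => K.erase v ∈ maxCliques G W).card ≤ (maxCliques G W).card := by
      refine Finset.card_le_card_of_injOn (fun K => K.erase v) ?_ ?_
      · intro K hK
        exact (Finset.mem_filter.1 hK).2
      -- If `K` and `L` agree off `v` and only `K` contains `v`, then `v` could be added to `L`,
      -- against maximality.
      · have key : ∀ K ∈ M, ∀ L ∈ M, K.erase v = L.erase v → v ∈ K → v ∈ L := by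
          intro K hK L hL h hvK
          by_contra hvL
          obtain ⟨-, -, h3⟩ := mem_maxCliques.1 hL
          obtain ⟨w, hw, hvw⟩ := h3 v (Finset.mem_insert_self _ _) hvL
          rw [Finset.erase_eq_of_notMem hvL] at h
          rw [← h, Finset.mem_erase] at hw
          exact hvw ((mem_maxCliques.1 hK).2.1 hvK hw.2 hw.1.symm)
        intro K hK L hL h
        have hK := (Finset.mem_filter.1 hK).1
        have hL := (Finset.mem_filter.1 hL).1
        have hiff : v ∈ K ↔ v ∈ L := ⟨key K hK L hL h, key L hL K hK h.symm⟩
        ext x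
        by_cases hx : x = v
        · rw [hx, hiff]
        · have := congrArg (x ∈ ·) h
          simpa [hx] using this
    let C : V → Finset V := fun u => W.filter fun w => G.Adj u w ∧ G.Adj v w
    have h2 : (M.filter fun K => ¬ K.erase v ∈ maxCliques G W) ⊆
        (W.filter fun u => ¬ G.Adj u v).biUnion fun u =>
          M.filter fun K => v ∈ K ∧ K.erase v ∈ maxCliques G (C u) := by
      intro K hK
      obtain ⟨hK, hne⟩ := Finset.mem_filter.1 hK
      obtain ⟨k1, k2, k3⟩ := mem_maxCliques.1 hK
      have hsub : K.erase v ⊆ W := by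
        intro x hx
        have := Finset.mem_erase.1 hx
        exact (Finset.mem_insert.1 (k1 this.2)).resolve_left this.1
      have hcl := isClique_subset k2 (Finset.erase_subset v K)
      have : ∃ u ∈ W, u ∉ K.erase v ∧ ∀ w ∈ K.erase v, G.Adj u w := by
        by_contra! hcon
        exact hne (mem_maxCliques.2 ⟨hsub, hcl, hcon⟩)
      obtain ⟨u, huW, huK, hu⟩ := this
      have huv : u ≠ v := fun h => hv (h ▸ huW)
      obtain ⟨w, hwK, huw⟩ := k3 u (Finset.mem_insert_of_mem huW) fun h =>
        huK (Finset.mem_erase.2 ⟨huv, h⟩)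
      -- Since `u` is adjacent to all of `K - v`, the only member of `K` that can exclude `u` is
      -- `v`.
      obtain rfl : w = v := by
        by_contra hwv
        exact huw (hu w (Finset.mem_erase.2 ⟨hwv, hwK⟩))
      refine Finset.mem_biUnion.2 ⟨u, Finset.mem_filter.2 ⟨huW, huw⟩,
        Finset.mem_filter.2 ⟨hK, hwK, mem_maxCliques.2 ⟨?_, hcl, ?_⟩⟩⟩
      · intro x hx
        have hx' := Finset.mem_erase.1 hx
        exact Finset.mem_filter.2 ⟨hsub hx, hu x hx, k2 hwK hx'.2 hx'.1.symm⟩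
      · intro x hx hxK
        obtain ⟨hxW, -, hvx⟩ := Finset.mem_filter.1 hx
        obtain ⟨y, hy, hxy⟩ := k3 x (Finset.mem_insert_of_mem hxW) fun h =>
          hxK (Finset.mem_erase.2 ⟨hvx.ne', h⟩)
        exact ⟨y, Finset.mem_erase.2 ⟨fun h => hxy (h ▸ hvx.symm), hy⟩, hxy⟩
    have h3 : ∀ u ∈ W.filter (fun u => ¬ G.Adj u v),
        ((M.filter fun K => v ∈ K ∧ K.erase v ∈ maxCliques G (C u)).card : ℝ) ≤
          (3 : ℝ) ^ ((c : ℝ) / 3) := by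
      intro u hu
      obtain ⟨huW, huv⟩ := Finset.mem_filter.1 hu
      have hle : (M.filter fun K => v ∈ K ∧ K.erase v ∈ maxCliques G (C u)).card ≤
          (maxCliques G (C u)).card := by
        refine Finset.card_le_card_of_injOn (fun K => K.erase v) ?_ ?_
        · intro K hK
          exact (Finset.mem_filter.1 hK).2.2
        · intro K hK L hL h
          rw [← Finset.insert_erase (Finset.mem_filter.1 hK).2.1,
            ← Finset.insert_erase (Finset.mem_filter.1 hL).2.1]
          exact congrArg _ h
      have hC : (C u).card < c := (Finset.card_le_card
        (Finset.filter_subset_filter _ (Finset.subset_insert v W))).trans_lt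
        (hW u (Finset.mem_insert_of_mem huW) v (Finset.mem_insert_self _ _)
          (fun h => hv (h ▸ huW)) huv)
      refine (Nat.cast_le.2 hle).trans ((card_maxCliques_le _).trans ?_)
      refine Real.rpow_le_rpow_of_exponent_le (by norm_num) ?_
      have : ((C u).card : ℝ) ≤ c := by exact_mod_cast hC.le
      linarith
    have h4 : ((M.filter fun K => ¬ K.erase v ∈ maxCliques G W).card : ℝ) ≤
        W.card * (3 : ℝ) ^ ((c : ℝ) / 3) := by
      calc _ ≤ ((∑ u ∈ W.filter (fun u => ¬ G.Adj u v),
            (M.filter fun K => v ∈ K ∧ K.erase v ∈ maxCliques G (C u)).card : ℕ) : ℝ) := by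
            exact_mod_cast (Finset.card_le_card h2).trans Finset.card_biUnion_le
        _ ≤ ∑ u ∈ W.filter (fun u => ¬ G.Adj u v), (3 : ℝ) ^ ((c : ℝ) / 3) := by
            rw [Nat.cast_sum]
            exact Finset.sum_le_sum h3
        _ = (W.filter fun u => ¬ G.Adj u v).card * (3 : ℝ) ^ ((c : ℝ) / 3) := by simp
        _ ≤ _ := by
            gcongr
            exact Finset.filter_subset _ _
    have h5 : (M.card : ℝ) = (M.filter fun K => K.erase v ∈ maxCliques G W).card +
        (M.filter fun K => ¬ K.erase v ∈ maxCliques G W).card := by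
      exact_mod_cast (Finset.card_filter_add_card_filter_not _).symm
    have h1' : ((M.filter fun K => K.erase v ∈ maxCliques G W).card : ℝ) ≤
        (maxCliques G W).card := by exact_mod_cast h1
    -- With `m = W.card`, at most `m` batches are added, and `m ^ 2 + m ≤ (m + 1) ^ 2`.
    rw [Finset.card_insert_of_notMem hv]
    push_cast
    have hWc : (0 : ℝ) ≤ W.card := by positivity
    nlinarith [mul_nonneg hWc (zero_le_one.trans hone)]

-- Once the trace `A` of `K` on `S` is fixed, `K \ S` is a maximal clique among the vertices outside
-- `S` that are adjacent to all of `A`, and it determines `K`. There are `2 ^ S.card` traces.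
open Classical in
theorem card_maxCliques_le_two_pow_mul {c N : ℕ} (S W : Finset V) (hN : W.card ≤ N)
    (hW : ∀ u ∈ W \ S, ∀ v ∈ W \ S, u ≠ v → ¬ G.Adj u v →
      ((W \ S).filter fun w => G.Adj u w ∧ G.Adj v w).card < c) :
    ((maxCliques G W).card : ℝ) ≤ 2 ^ S.card * ((1 + (N : ℝ) ^ 2) * (3 : ℝ) ^ ((c : ℝ) / 3)) := by
  let B : Finset V → Finset V := fun A => (W \ S).filter fun x => ∀ a ∈ A, G.Adj a x
  have h1 : maxCliques G W ⊆ S.powerset.biUnion fun A =>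
      (maxCliques G W).filter fun K => K ∩ S = A := by
    intro K hK
    exact Finset.mem_biUnion.2 ⟨K ∩ S, by simp, by simp [hK]⟩
  have h2 : ∀ A ∈ S.powerset, (((maxCliques G W).filter fun K => K ∩ S = A).card : ℝ) ≤
      (1 + (N : ℝ) ^ 2) * (3 : ℝ) ^ ((c : ℝ) / 3) := by
    intro A _
    have hle : ((maxCliques G W).filter fun K => K ∩ S = A).card ≤ (maxCliques G (B A)).card := by
      refine Finset.card_le_card_of_injOn (fun K => K \ S) ?_ ?_
      · intro K hK
        obtain ⟨hKW, rfl⟩ := Finset.mem_filter.1 hK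
        obtain ⟨k1, k2, k3⟩ := mem_maxCliques.1 hKW
        refine mem_maxCliques.2 ⟨?_, isClique_subset k2 Finset.sdiff_subset, ?_⟩
        · intro x hx
          have hx' := Finset.mem_sdiff.1 hx
          refine Finset.mem_filter.2 ⟨Finset.mem_sdiff.2 ⟨k1 hx'.1, hx'.2⟩, fun a ha => ?_⟩
          have ha' := Finset.mem_inter.1 ha
          exact k2 ha'.1 hx'.1 fun h => hx'.2 (h ▸ ha'.2)
        · intro x hx hxK
          obtain ⟨hxW, hxA⟩ := Finset.mem_filter.1 hx
          obtain ⟨hxW, hxS⟩ := Finset.mem_sdiff.1 hxW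
          obtain ⟨w, hw, hxw⟩ := k3 x hxW fun h => hxK (Finset.mem_sdiff.2 ⟨h, hxS⟩)
          exact ⟨w, Finset.mem_sdiff.2 ⟨hw, fun h =>
            hxw (hxA w (Finset.mem_inter.2 ⟨hw, h⟩)).symm⟩, hxw⟩
      · intro K hK L hL h
        have hKA := (Finset.mem_filter.1 hK).2
        have hLA := (Finset.mem_filter.1 hL).2
        rw [← Finset.sdiff_union_inter K S, ← Finset.sdiff_union_inter L S, hKA, hLA]
        exact congrArg (· ∪ A) h
    have hB : ∀ u ∈ B A, u ∈ W \ S := fun u hu => (Finset.mem_filter.1 hu).1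
    refine (Nat.cast_le.2 hle).trans ((card_maxCliques_le_of_closed (c := c) _
      fun u hu v hv huv hadj => (Finset.card_le_card
      (Finset.filter_subset_filter _ (Finset.filter_subset _ _))).trans_lt
      (hW u (hB u hu) v (hB v hv) huv hadj)).trans ?_)
    have : ((B A).card : ℝ) ≤ N := by
      exact_mod_cast (Finset.card_le_card fun u hu => (Finset.mem_sdiff.1 (hB u hu)).1).trans hN
    gcongr
  calc ((maxCliques G W).card : ℝ)
      ≤ ((∑ A ∈ S.powerset, ((maxCliques G W).filter fun K => K ∩ S = A).card : ℕ) : ℝ) := by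
        exact_mod_cast (Finset.card_le_card h1).trans Finset.card_biUnion_le
    _ ≤ ∑ A ∈ S.powerset, (1 + (N : ℝ) ^ 2) * (3 : ℝ) ^ ((c : ℝ) / 3) := by
        rw [Nat.cast_sum]
        exact Finset.sum_le_sum h2
    _ = _ := by
        rw [Finset.sum_const, Finset.card_powerset, nsmul_eq_mul]
        push_cast
        ring

end MaxCliques

end AlmostClosed

namespace AlmostClosed

/-! ### Enumerating maximal cliques by adding one vertex after another -/

section Extend

variable {V : Type*} [LinearOrder V] {G : SimpleGraph V}

/-- Maximal cliques form an antichain. -/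
theorem eq_of_subset_of_mem_maxCliques {W K L : Finset V} (hK : K ∈ maxCliques G W)
    (hL : L ∈ maxCliques G W) (h : K ⊆ L) : K = L := by
  refine h.antisymm fun x hx => ?_
  by_contra hxK
  obtain ⟨w, hw, hxw⟩ := (mem_maxCliques.1 hK).2.2 x ((mem_maxCliques.1 hL).1 hx) hxK
  exact hxw ((mem_maxCliques.1 hL).2.1 hx (h hw) fun h => hxK (h ▸ hw))

/-- `K` is the result of extending the clique `X` greedily by vertices of `W`. -/
def IsGreedy (G : SimpleGraph V) (W X K : Finset V) : Prop :=
  ∀ u ∈ W, u ∉ K → ∃ w ∈ K, ¬ G.Adj u w ∧ (w ∈ X ∨ w < u)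

theorem exists_isGreedy {X : Finset V} (hX : G.IsClique (X : Set V)) (W : Finset V) :
    ∃ K, X ⊆ K ∧ K ⊆ X ∪ W ∧ G.IsClique (K : Set V) ∧ IsGreedy G W X K := by
  induction W using Finset.induction_on_max with
  | empty => exact ⟨X, subset_rfl, by simp, hX, by simp [IsGreedy]⟩
  | insert a W ha ih =>
    obtain ⟨K, h1, h2, h3, h4⟩ := ih
    have h2' : K ⊆ X ∪ insert a W := h2.trans (by gcongr; exact Finset.subset_insert _ _)
    by_cases hK : ∀ w ∈ K, w ≠ a → G.Adj a w
    · refine ⟨insert a K, h1.trans (Finset.subset_insert _ _), ?_, ?_, ?_⟩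
      · exact Finset.insert_subset (by simp) h2'
      · rw [Finset.coe_insert, SimpleGraph.isClique_insert]
        exact ⟨h3, fun b hb hab => hK b hb hab.symm⟩
      · intro u hu huK
        simp only [Finset.mem_insert, not_or] at hu huK
        obtain ⟨w, hw, hw'⟩ := h4 u (hu.resolve_left huK.1) huK.2
        exact ⟨w, Finset.mem_insert_of_mem hw, hw'⟩
    · push Not at hK
      obtain ⟨w, hw, hwa, haw⟩ := hK
      refine ⟨K, h1, h2', h3, fun u hu huK => ?_⟩
      rcases Finset.mem_insert.1 hu with rfl | hu
      · exact ⟨w, hw, haw, (Finset.mem_union.1 (h2 hw)).imp_right fun h => ha w h⟩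
      · exact h4 u hu huK

/-- At the smallest vertex `u` in which `K` and `L` differ, the member that rejects `u` from one of
them is in `X` or smaller than `u`. It therefore lies in both, and so it contradicts that the other
is a clique containing `u`. -/
theorem IsGreedy.eq {W X K L : Finset V} (hK : IsGreedy G W X K) (hL : IsGreedy G W X L)
    (hXK : X ⊆ K) (hXL : X ⊆ L) (hKW : K ⊆ W) (hLW : L ⊆ W) (hKc : G.IsClique (K : Set V))
    (hLc : G.IsClique (L : Set V)) : K = L := by
  by_contra hne
  have hD : (symmDiff K L).Nonempty := by
    rw [Finset.nonempty_iff_ne_empty]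
    exact fun h => hne (symmDiff_eq_bot.1 h)
  obtain ⟨u, hu, hmin⟩ : ∃ u ∈ symmDiff K L, ∀ w ∈ symmDiff K L, u ≤ w :=
    ⟨_, Finset.min'_mem _ hD, fun w hw => Finset.min'_le _ w hw⟩
  have key : ∀ {K L : Finset V}, IsGreedy G W X L → X ⊆ K → K ⊆ W → G.IsClique (K : Set V) →
      u ∈ K → u ∉ L → (∀ w ∈ symmDiff K L, u ≤ w) → False := by
    intro K L hL hXK hKW hKc huK huL hmin
    obtain ⟨w, hw, huw, hwX⟩ := hL u (hKW huK) huL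
    have hwK : w ∈ K := by
      rcases hwX with h | h
      · exact hXK h
      · by_contra hwK
        exact (hmin w (by simp [Finset.mem_symmDiff, hw, hwK])).not_gt h
    exact huw (hKc huK hwK fun h => huL (h ▸ hw))
  rcases Finset.mem_symmDiff.1 hu with h | h
  · exact key hL hXK hKW hKc h.1 h.2 hmin
  · exact key hK hXL hLW hLc h.1 h.2 (by rwa [symmDiff_comm])

open Classical in
/-- The maximal cliques of `insert v W` that descend from the maximal clique `K` of `W`. -/
noncomputable def extendClique (G : SimpleGraph V) (W : Finset V) (v : V) (K : Finset V) :
    List (Finset V) :=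
  if ∀ w ∈ K, G.Adj v w then [insert v K]
  -- The first condition says that `K` is the greedy extension of its part adjacent to `v`; the
  -- second says that this part together with `v` is maximal. Members of `K` outside the part need
  -- no check, being nonadjacent to `v`.
  else K :: if ∀ u ∈ W, u ∉ K → (∃ w ∈ K, ¬ G.Adj u w ∧ (G.Adj v w ∨ w < u)) ∧
      (G.Adj u v → ∃ w ∈ K, ¬ G.Adj u w ∧ G.Adj v w)
    then [insert v (K.filter fun w => G.Adj v w)] else []

open Classical in
theorem mem_extendClique {W K M : Finset V} {v : V} : M ∈ extendClique G W v K ↔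
    (∀ w ∈ K, G.Adj v w) ∧ M = insert v K ∨
    (¬ ∀ w ∈ K, G.Adj v w) ∧ (M = K ∨ M = insert v (K.filter fun w => G.Adj v w) ∧
      IsGreedy G W (K.filter fun w => G.Adj v w) K ∧
      ∀ u ∈ W, u ∉ K → G.Adj u v → ∃ w ∈ K, ¬ G.Adj u w ∧ G.Adj v w) := by
  have hg : IsGreedy G W (K.filter fun w => G.Adj v w) K ↔
      ∀ u ∈ W, u ∉ K → ∃ w ∈ K, ¬ G.Adj u w ∧ (G.Adj v w ∨ w < u) := by
    refine forall₃_congr fun u _ _ => exists_congr fun w => ?_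
    simp only [Finset.mem_filter]
    tauto
  rw [hg, extendClique]
  split_ifs with h1 h2
  · simp only [List.mem_singleton]
    tauto
  · simp only [List.mem_cons, List.not_mem_nil, or_false]
    have h3 := fun u hu huK => (h2 u hu huK).1
    have h4 := fun u hu huK => (h2 u hu huK).2
    tauto
  · simp only [List.mem_singleton]
    have : ¬ ((∀ u ∈ W, u ∉ K → ∃ w ∈ K, ¬ G.Adj u w ∧ (G.Adj v w ∨ w < u)) ∧
      ∀ u ∈ W, u ∉ K → G.Adj u v → ∃ w ∈ K, ¬ G.Adj u w ∧ G.Adj v w) :=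
      fun h => h2 fun u hu huK => ⟨h.1 u hu huK, h.2 u hu huK⟩
    tauto

/-- The forward direction finds the parent: `M` itself, `M - v`, or the greedy extension of `M - v`.
-/
theorem mem_maxCliques_insert {W M : Finset V} {v : V} (hv : v ∉ W) :
    M ∈ maxCliques G (insert v W) ↔ ∃ K ∈ maxCliques G W, M ∈ extendClique G W v K := by
  classical
  constructor
  · intro hM
    obtain ⟨m1, m2, m3⟩ := mem_maxCliques.1 hM
    by_cases hvM : v ∈ M
    · set X := M.erase v with hXdef
      have hXM : insert v X = M := Finset.insert_erase hvM
      have hXW : X ⊆ W := fun x hx =>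
        (Finset.mem_insert.1 (m1 (Finset.mem_of_mem_erase hx))).resolve_left
          (Finset.ne_of_mem_erase hx)
      have hXv : ∀ w ∈ X, G.Adj v w := fun w hw =>
        m2 hvM (Finset.mem_of_mem_erase hw) (Finset.ne_of_mem_erase hw).symm
      have hXc := isClique_subset m2 (Finset.erase_subset v M)
      by_cases hX : X ∈ maxCliques G W
      · exact ⟨X, hX, mem_extendClique.2 (.inl ⟨hXv, hXM.symm⟩)⟩
      · obtain ⟨K, k1, k2, k3, k4⟩ := exists_isGreedy hXc W
        have hKW : K ⊆ W := k2.trans (Finset.union_subset hXW subset_rfl)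
        have hK : K ∈ maxCliques G W := mem_maxCliques.2 ⟨hKW, k3, fun u hu huK => by
          obtain ⟨w, hw, huw, -⟩ := k4 u hu huK
          exact ⟨w, hw, huw⟩⟩
        -- A neighbor `w` of `v` in `K` outside `X` would be adjacent to `v` and to all of `X`,
        -- hence could be added to `M`.
        have hKX : (K.filter fun w => G.Adj v w) = X := by
          ext w
          rw [Finset.mem_filter]
          refine ⟨fun ⟨hw, hvw⟩ => ?_, fun hw => ⟨k1 hw, hXv w hw⟩⟩
          by_contra hwX
          obtain ⟨y, hy, hwy⟩ := m3 w (Finset.mem_insert_of_mem (hKW hw)) fun h =>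
            hwX (Finset.mem_erase.2 ⟨hvw.ne', h⟩)
          by_cases hyv : y = v
          · exact hwy (hyv ▸ hvw.symm)
          · have hyX : y ∈ X := Finset.mem_erase.2 ⟨hyv, hy⟩
            exact hwy (k3 hw (k1 hyX) fun h => hwX (h ▸ hyX))
        refine ⟨K, hK, mem_extendClique.2 (.inr ⟨fun h => hX ?_, .inr ⟨?_, ?_, ?_⟩⟩)⟩
        · rwa [← hKX, Finset.filter_true_of_mem h]
        · rw [hKX, hXM]
        · rwa [hKX]
        · intro u hu huK huv
          obtain ⟨w, hw, huw⟩ := m3 u (Finset.mem_insert_of_mem hu) fun h =>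
            huK (k1 (Finset.mem_erase.2 ⟨huv.ne, h⟩))
          have hwX : w ∈ X := Finset.mem_erase.2 ⟨fun h => huw (h ▸ huv), hw⟩
          exact ⟨w, k1 hwX, huw, hXv w hwX⟩
    · have hMW : M ⊆ W := fun x hx =>
        (Finset.mem_insert.1 (m1 hx)).resolve_left fun h => hvM (h ▸ hx)
      refine ⟨M, mem_maxCliques.2 ⟨hMW, m2, fun u hu => m3 u (Finset.mem_insert_of_mem hu)⟩,
        mem_extendClique.2 (.inr ⟨fun h => ?_, .inl rfl⟩)⟩
      obtain ⟨w, hw, hvw⟩ := m3 v (Finset.mem_insert_self _ _) hvM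
      exact hvw (h w hw)
  · rintro ⟨K, hK, hM⟩
    obtain ⟨k1, k2, k3⟩ := mem_maxCliques.1 hK
    have hvK : v ∉ K := fun h => hv (k1 h)
    rw [mem_maxCliques]
    rcases mem_extendClique.1 hM with ⟨h, rfl⟩ | ⟨h, rfl | ⟨rfl, h1, h2⟩⟩
    · refine ⟨Finset.insert_subset_insert _ k1, ?_, ?_⟩
      · rw [Finset.coe_insert, SimpleGraph.isClique_insert]
        exact ⟨k2, fun b hb _ => h b hb⟩
      · intro u hu huK
        simp only [Finset.mem_insert, not_or] at hu huK
        obtain ⟨w, hw, huw⟩ := k3 u (hu.resolve_left huK.1) huK.2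
        exact ⟨w, Finset.mem_insert_of_mem hw, huw⟩
    · refine ⟨k1.trans (Finset.subset_insert _ _), k2, fun u hu huK => ?_⟩
      rcases Finset.mem_insert.1 hu with rfl | hu
      · push Not at h
        exact h
      · exact k3 u hu huK
    · refine ⟨Finset.insert_subset_insert _ ((Finset.filter_subset _ _).trans k1), ?_, ?_⟩
      · rw [Finset.coe_insert, SimpleGraph.isClique_insert]
        exact ⟨isClique_subset k2 (Finset.filter_subset _ _),
          fun b hb _ => (Finset.mem_filter.1 hb).2⟩
      · intro u hu huK
        simp only [Finset.mem_insert, not_or, Finset.mem_filter, not_and] at hu huK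
        have huW := hu.resolve_left huK.1
        by_cases huv : G.Adj u v
        · obtain ⟨w, hw, huw, hvw⟩ := h2 u huW (fun h => huK.2 h huv.symm) huv
          exact ⟨w, by simp [hw, hvw], huw⟩
        · exact ⟨v, by simp, huv⟩

/-- A child without `v` is its own parent. If `K + v` equals the part of `L` adjacent to `v` plus
`v`, then `K ⊆ L` and the antichain property applies. If two parents give the same proper part, both
are its greedy extension, which is unique. -/
theorem nodup_flatMap_extendClique {W : Finset V} {v : V} (hv : v ∉ W) {L : List (Finset V)}
    (hL : L.Nodup) (hLW : ∀ K ∈ L, K ∈ maxCliques G W) :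
    (L.flatMap (extendClique G W v)).Nodup := by
  classical
  have hvK : ∀ {K}, K ∈ maxCliques G W → v ∉ K := fun hK h => hv ((mem_maxCliques.1 hK).1 h)
  rw [List.nodup_flatMap]
  refine ⟨fun K hK => ?_, hL.pairwise_of_forall_ne fun K hK L hL hne M hMK hML => hne ?_⟩
  · have := hvK (hLW K hK)
    rw [extendClique]
    split_ifs
    · simp
    · simp only [List.nodup_cons, List.mem_singleton, List.not_mem_nil, not_false_eq_true,
        List.nodup_nil, and_true]
      exact fun h => this (h ▸ Finset.mem_insert_self _ _)
    · simp
  · have hK := hLW K hK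
    have hL := hLW L hL
    have hfilter : ∀ {K L : Finset V}, K ∈ maxCliques G W → L ∈ maxCliques G W →
        insert v K = insert v (L.filter fun w => G.Adj v w) → K = L := by
      intro K L hK hL h
      refine eq_of_subset_of_mem_maxCliques hK hL ?_
      have := congrArg (fun A => A.erase v) h
      simp only [Finset.erase_insert (hvK hK)] at this
      rw [this]
      exact (Finset.erase_insert_subset _ _).trans (Finset.filter_subset _ _)
    rcases mem_extendClique.1 hMK with ⟨-, rfl⟩ | ⟨-, rfl | ⟨rfl, h1, -⟩⟩
    · rcases mem_extendClique.1 hML with ⟨-, h⟩ | ⟨-, h | ⟨h, -, -⟩⟩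
      · have := congrArg (fun A => A.erase v) h
        simpa [Finset.erase_insert (hvK hK), Finset.erase_insert (hvK hL)] using this
      · exact absurd (h ▸ Finset.mem_insert_self _ _) (hvK hL)
      · exact hfilter hK hL h
    · rcases mem_extendClique.1 hML with ⟨-, h⟩ | ⟨-, h | ⟨h, -, -⟩⟩
      · exact absurd (h ▸ Finset.mem_insert_self _ _) (hvK hK)
      · exact h
      · exact absurd (h ▸ Finset.mem_insert_self _ _) (hvK hK)
    · rcases mem_extendClique.1 hML with ⟨-, h⟩ | ⟨-, h | ⟨h, h2, -⟩⟩
      · exact (hfilter hL hK h.symm).symm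
      · exact absurd (h ▸ Finset.mem_insert_self _ _) (hvK hL)
      · have heq : (K.filter fun w => G.Adj v w) = L.filter fun w => G.Adj v w := by
          have := congrArg (fun A => A.erase v) h
          simpa [Finset.erase_insert, hvK hK, hvK hL] using this
        rw [← heq] at h2
        exact h1.eq h2 (Finset.filter_subset _ _) (heq ▸ Finset.filter_subset _ _)
          (mem_maxCliques.1 hK).1 (mem_maxCliques.1 hL).1 (mem_maxCliques.1 hK).2.1
          (mem_maxCliques.1 hL).2.1

end Extend

end AlmostClosed

/-! ### From the combinatorics to the clique program -/

namespace AlmostClosed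

/-! ### Polynomial bounds -/

/-- A function that is bounded by a polynomial. -/
def PolyBounded (f : ℕ → ℕ) : Prop := ∃ C D, ∀ n, f n ≤ C * (n + 1) ^ D

namespace PolyBounded

variable {f g : ℕ → ℕ}

theorem const (m : ℕ) : PolyBounded fun _ => m := ⟨m, 0, fun n => by simp⟩

theorem id : PolyBounded fun n => n := ⟨1, 1, fun n => by simp⟩

theorem add (hf : PolyBounded f) (hg : PolyBounded g) : PolyBounded fun n => f n + g n := by
  obtain ⟨C, D, h⟩ := hf
  obtain ⟨C', D', h'⟩ := hg
  refine ⟨C + C', D + D', fun n => ?_⟩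
  rw [add_mul]
  refine add_le_add ((h n).trans ?_) ((h' n).trans ?_)
  · gcongr <;> omega
  · gcongr <;> omega

theorem mul (hf : PolyBounded f) (hg : PolyBounded g) : PolyBounded fun n => f n * g n := by
  obtain ⟨C, D, h⟩ := hf
  obtain ⟨C', D', h'⟩ := hg
  refine ⟨C * C', D + D', fun n => (Nat.mul_le_mul (h n) (h' n)).trans ?_⟩
  rw [pow_add]
  exact le_of_eq (by ring)

end PolyBounded

theorem Expr.polyBounded_cost (e : Expr) : PolyBounded e.cost := by
  have h := PolyBounded.const
  have hid := PolyBounded.id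
  induction e with
  | reg x => exact h 1
  | lit m => exact h 1
  | get a x => exact h 1
  | adj x y => exact (((hid.mul ((hid.mul (h 3)).add (h 4))).add (hid.mul (h 3))).add (h 9))
  | lt e f ihe ihf => exact (ihe.add ihf).add (h 2)
  | ite e f g ihe ihf ihg => exact ((ihe.add ihf).add ihg).add (h 2)
  | count i e ih => exact (hid.mul (ih.add (h 5))).add (h 5)

theorem Cmd.polyBounded_cost (c : Cmd) : PolyBounded c.cost := by
  have h := PolyBounded.const
  have hid := PolyBounded.id
  have happ : ∀ φ, PolyBounded (Cmd.appCost φ) := fun φ =>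
    (hid.mul (φ.polyBounded_cost.add (h 7))).add (h 5)
  induction c with
  | nil => exact h 1
  | app φ => exact happ φ
  | each ψ φ => exact (hid.mul ((ψ.polyBounded_cost.add (happ φ)).add (h 4))).add (h 4)
  | ite e c d ihc ihd => exact ((e.polyBounded_cost.add ihc).add ihd).add (h 2)
  | seq c d ihc ihd => exact ihc.add ihd

/-! ### The encoding of the input -/

theorem ite_one_zero_pos (p : Prop) [Decidable p] : (0 < if p then 1 else 0) ↔ p := by
  split_ifs <;> simp [*]

namespace Expr

variable {s : State}

@[simp] theorem sat_get {a x : ℕ} : (Expr.get a x).Sat s ↔ 0 < s.arr a (s.reg x) := Iff.rfl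

@[simp] theorem sat_adj {x y : ℕ} : (Expr.adj x y).Sat s ↔
    (s.reg x < s.reg 0 ∧ s.reg y < s.reg 0) ∧ 0 < s.arr 0 (s.reg x * s.reg 0 + s.reg y) := by
  simp only [Sat, eval]
  split_ifs with h <;> simp [h]

@[simp] theorem sat_lt_reg {x y : ℕ} :
    (Expr.lt (.reg x) (.reg y)).Sat s ↔ s.reg x < s.reg y := sat_lt

end Expr

open Classical in
/-- The state shows the graph `G` and the set `S` as its input. -/
structure Shows {n : ℕ} (G : SimpleGraph (Fin n)) (S : Finset (Fin n)) (s : State) : Prop where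
  size : s.reg 0 = n
  adj : ∀ x y : Fin n, s.arr 0 (x * n + y) = if G.Adj x y then 1 else 0
  mem : ∀ x : Fin n, s.arr 1 x = if x ∈ S then 1 else 0

theorem Shows.vis {n : ℕ} {G : SimpleGraph (Fin n)} {S : Finset (Fin n)} {s s' : State}
    (h : Shows G S s) (hs : Vis s s') : Shows G S s' :=
  ⟨by rw [hs.reg 0 (by simp) (by simp), h.size], by
    rw [hs.arr 0 (by simp) (by simp)]
    exact h.adj, by
    rw [hs.arr 1 (by simp) (by simp)]
    exact h.mem⟩

theorem shows_inputState {n : ℕ} (G : SimpleGraph (Fin n)) (S : Finset (Fin n)) (p : ℕ) :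
    Shows G S (inputState G S p) := by
  classical
  refine ⟨by simp [inputState], fun x y => ?_, fun x => ?_⟩
  · have : (∃ u v : Fin n, G.Adj u v ∧ x.val * n + y.val = u.val * n + v.val) ↔ G.Adj x y := by
      refine ⟨fun ⟨u, v, huv, h⟩ => ?_, fun h => ⟨x, y, h, rfl⟩⟩
      have hn : 0 < n := x.pos
      have hx := congrArg (· / n) h
      -- Row and column are recovered from the matrix index as quotient and remainder modulo `n`.
      have hy := congrArg (· % n) h
      simp only [Nat.mul_add_mod_self_right, Nat.mod_eq_of_lt, Fin.is_lt] at hy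
      simp only [mul_comm _ n, Nat.mul_add_div hn, Nat.div_eq_of_lt, Fin.is_lt, add_zero] at hx
      rwa [Fin.ext hx, Fin.ext hy]
    simp only [inputState, if_true, this]
  · have : (∃ v ∈ S, x.val = v.val) ↔ x ∈ S :=
      ⟨fun ⟨v, hv, h⟩ => Fin.ext h ▸ hv, fun h => ⟨x, h, rfl⟩⟩
    simp [inputState, this]

/-! ### The algorithm for maximal cliques -/

section CliqueAlgorithm

open AlmostClosed.Expr

/-- The vertex in the register `2` is adjacent to the whole current set. -/
def allAdjExpr : Expr := .all 6 ((get 3 6).not.or (adj 2 6))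

/-- The current clique is the parent of the clique that consists of the vertex in the register `2`
and of its neighbors in the current clique, and the latter is maximal. -/
def parentExpr : Expr :=
  .all 6 <| (Expr.lt (reg 6) (reg 2)).not.or <| (get 3 6).or <|
    (Expr.ex 7 <| (get 3 7).and <| (adj 6 7).not.and <| (adj 2 7).or (.lt (reg 7) (reg 6))).and <|
    (adj 6 2).not.or <| Expr.ex 7 <| (get 3 7).and <| (adj 6 7).not.and (adj 2 7)

/-- The command that extends the current clique by the vertex in the register `2`. -/
def extendCmd : Cmd :=
  .ite allAdjExpr (.app ((get 3 5).or (Expr.eq 5 2))) <|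
    .seq (.app (get 3 5)) <|
      .ite parentExpr (.app ((Expr.eq 5 2).or ((get 3 5).and (adj 2 5)))) .nil

theorem extendCmd_wf : extendCmd.WF := by
  simp [extendCmd, allAdjExpr, parentExpr, Cmd.WF, Expr.WF, Expr.all, Expr.ex, Expr.not, Expr.or,
    Expr.and, Expr.eq]

variable {n : ℕ} {G : SimpleGraph (Fin n)} {S K : Finset (Fin n)} {s : State}

theorem sat_allAdjExpr (hs : Shows G S s) (hK : IsCurrent K s) {v : Fin n} (hv : s.reg 2 = v) :
    allAdjExpr.Sat s ↔ ∀ w ∈ K, G.Adj v w := by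
  classical
  have hK' : ∀ w : Fin n, s.arr 3 w = if w ∈ K then 1 else 0 := hK
  simp only [allAdjExpr]
  rw [sat_all hs.size]
  refine forall_congr' fun w => ?_
  simp [hs.size, hv, hs.adj, hK', ite_one_zero_pos, -ite_not, imp_iff_not_or]

theorem sat_parentExpr (hs : Shows G S s) (hK : IsCurrent K s) {v : Fin n} (hv : s.reg 2 = v) :
    parentExpr.Sat s ↔ ∀ u ∈ Finset.univ.filter (· < v), u ∉ K →
      (∃ w ∈ K, ¬ G.Adj u w ∧ (G.Adj v w ∨ w < u)) ∧
      (G.Adj u v → ∃ w ∈ K, ¬ G.Adj u w ∧ G.Adj v w) := by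
  classical
  have hK' : ∀ w : Fin n, s.arr 3 w = if w ∈ K then 1 else 0 := hK
  simp only [parentExpr]
  rw [sat_all hs.size]
  refine forall_congr' fun u => ?_
  have h0 : (s.setReg 6 u).reg 0 = n := by simp [hs.size]
  simp only [sat_or, sat_and, sat_not, sat_ex h0]
  simp only [sat_lt_reg, sat_get, sat_adj, State.setReg_reg, State.setReg_arr, hs.size, hv, hs.adj,
    hK', ite_one_zero_pos, reduceIte, Nat.reduceEqDiff, Fin.is_lt, and_self, true_and,
    Finset.mem_filter, Finset.mem_univ, Fin.val_fin_lt, OfNat.zero_ne_ofNat, imp_iff_not_or,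
    not_not]

theorem sem_extendCmd (hs : Shows G S s) (hK : IsCurrent K s) {v : Fin n} (hv : s.reg 2 = v) :
    extendCmd.sem s = extendClique G (Finset.univ.filter (· < v)) v K := by
  classical
  have hK' : ∀ w : Fin n, s.arr 3 w = if w ∈ K then 1 else 0 := hK
  have h3 : (Finset.univ.filter fun w : Fin n =>
      ((get 3 5).or (Expr.eq 5 2)).Sat (s.setReg 5 w)) = insert v K := by
    ext w
    simp [hv, hK', ite_one_zero_pos, Fin.ext_iff, or_comm]
  have h4 : (Finset.univ.filter fun w : Fin n => (get 3 5).Sat (s.setReg 5 w)) = K := by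
    ext w
    simp [hK', ite_one_zero_pos]
  have h5 : (Finset.univ.filter fun w : Fin n =>
      ((Expr.eq 5 2).or ((get 3 5).and (adj 2 5))).Sat (s.setReg 5 w)) =
      insert v (K.filter fun w => G.Adj v w) := by
    ext w
    simp [hv, hK', hs.adj, hs.size, ite_one_zero_pos, Fin.ext_iff]
  simp only [extendCmd, Cmd.sem, sat_allAdjExpr hs hK hv, sat_parentExpr hs hK hv, h3, h4, h5,
    extendClique]
  split_ifs <;> rfl

/-- The list of sets that the algorithm puts into the queue for `K` in the level `i`. -/
noncomputable def cliqueStep (G : SimpleGraph (Fin n)) (i : ℕ) (K : Finset (Fin n)) :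
    List (Finset (Fin n)) :=
  if h : i < n then extendClique G (Finset.univ.filter (· < (⟨i, h⟩ : Fin n))) ⟨i, h⟩ K else []

theorem levels_cliqueStep (G : SimpleGraph (Fin n)) {i : ℕ} (hi : i ≤ n) :
    (levels (cliqueStep G) [∅] i).Nodup ∧ ∀ K, K ∈ levels (cliqueStep G) [∅] i ↔
      K ∈ maxCliques G (Finset.univ.filter fun x : Fin n => x.val < i) := by
  induction i with
  | zero =>
    refine ⟨by simp [levels], fun K => ?_⟩
    simp only [levels, List.mem_singleton, mem_maxCliques, not_lt_zero, Finset.filter_false,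
      Finset.subset_empty, Finset.notMem_empty, false_imp_iff, implies_true, and_true]
    refine ⟨?_, fun h => h.1⟩
    rintro rfl
    simp
  | succ i ih =>
    obtain ⟨h1, h2⟩ := ih (by omega)
    have hv : (⟨i, hi⟩ : Fin n) ∉ Finset.univ.filter fun x : Fin n => x.val < i := by simp
    have hW : (Finset.univ.filter fun x : Fin n => x.val < i + 1) =
        insert ⟨i, hi⟩ (Finset.univ.filter fun x : Fin n => x.val < i) := by
      ext x
      simp [Fin.ext_iff]
      omega
    have hstep : cliqueStep G i =
        extendClique G (Finset.univ.filter fun x : Fin n => x.val < i) ⟨i, hi⟩ := by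
      funext K
      exact dif_pos hi
    rw [levels, hstep, hW]
    refine ⟨nodup_flatMap_extendClique hv h1 fun K hK => (h2 K).1 hK, fun K => ?_⟩
    simp only [List.mem_flatMap, h2, mem_maxCliques_insert hv]

/-- The program that enumerates the maximal cliques. -/
def cliqueProg : Prog := .seq initCode <| .seq (roundsCode 0 extendCmd) emitCode

theorem maximal_isClique_iff {K : Finset (Fin n)} :
    Maximal (fun T : Finset (Fin n) => G.IsClique (T : Set (Fin n))) K ↔
      K ∈ maxCliques G Finset.univ := by
  rw [mem_maxCliques]
  refine ⟨fun h => ⟨Finset.subset_univ _, h.prop, fun u _ hu => ?_⟩, fun ⟨_, h1, h2⟩ =>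
    ⟨h1, fun T hT hKT x hx => ?_⟩⟩
  · by_contra! hcon
    have : G.IsClique ((insert u K : Finset (Fin n)) : Set (Fin n)) := by
      rw [Finset.coe_insert, SimpleGraph.isClique_insert]
      exact ⟨h.prop, fun b hb _ => hcon b hb⟩
    exact hu (h.2 this (Finset.subset_insert u K) (Finset.mem_insert_self u K))
  · by_contra hxK
    obtain ⟨w, hw, hxw⟩ := h2 x (Finset.mem_univ x) hxK
    exact hxw (hT hx (hKT hw) fun h => hxK (h ▸ hw))

theorem reach_cliqueProg (G : SimpleGraph (Fin n)) (S : Finset (Fin n)) {B : ℕ}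
    (hB : ∀ i ≤ n, (maxCliques G (Finset.univ.filter fun x : Fin n => x.val < i)).card ≤ B) :
    Reach cliqueProg (inputState G S 0)
      (2 + (n * (B * (n * 5 + extendCmd.cost n + 4) + 4) + 2 + (B * (n * 6 + 5) + 2)))
      fun s => EnumeratesMaximalCliques G s.out := by
  have hlen : ∀ i ≤ n, (levels (cliqueStep G) [∅] i).length ≤ B := fun i hi => by
    obtain ⟨h1, h2⟩ := levels_cliqueStep G hi
    rw [← List.toFinset_card_of_nodup h1]
    refine (Finset.card_le_card fun K hK => ?_).trans (hB i hi)
    exact (h2 K).1 (List.mem_toFinset.1 hK)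
  have h0 : (inputState G S 0).reg 0 = n := (shows_inputState G S 0).size
  refine Reach.seq (reach_initCode h0 (by simp [inputState]) (by simp [inputState])
    (by simp [inputState])) ?_
  rintro s ⟨h1, h2, h3, h4⟩
  have hv : Vis (inputState G S 0) s := ⟨fun x hx _ => h1 x (by omega) (by omega),
    fun a _ _ => by rw [h2], h3⟩
  have hsh := (shows_inputState G S 0).vis hv
  have hn : s.reg 0 = n := hsh.size
  have hrounds := reach_roundsCode (b := 0) (by simp) (by simp) extendCmd_wf hn h4
    (cliqueStep G) (B := B) ?_ ?_
  · rw [hn] at hrounds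
    refine Reach.seq hrounds ?_
    rintro s' ⟨hv', hL⟩
    refine (reach_emitCode (hsh.vis hv').size hL).mono ?_ ?_
    · have := Nat.mul_le_mul_right (n * 6 + 5) (hlen n le_rfl)
      omega
    · intro s'' hout
      obtain ⟨hnd, hmem⟩ := levels_cliqueStep G (le_refl n)
      refine ⟨levels (cliqueStep G) [∅] n, hnd, fun K => ?_, ?_⟩
      · rw [hmem, maximal_isClique_iff, Finset.filter_true_of_mem fun x _ => x.2]
      · rw [hout, hv'.out, h3]
        simp [inputState]
  · intro v hvn K s' hs' h2' hK
    rw [hn] at hvn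
    rw [sem_extendCmd (hsh.vis hs') hK (v := ⟨v, hvn⟩) h2', cliqueStep, dif_pos hvn]
  · intro v hvn
    exact hlen v (by omega)

theorem exists_cliqueProg_bound : ∃ (C : ℝ) (a : ℕ),
    ∀ (n : ℕ) (G : SimpleGraph (Fin n)) (S : Finset (Fin n)) (k c : ℕ),
      S.card = k → IsCClosed (deleteVerts G S) c →
      ∃ (t : ℕ) (w : List ℕ), Outputs cliqueProg (inputState G S 0) t w ∧
        EnumeratesMaximalCliques G w ∧
        (t : ℝ) ≤ C * (2 : ℝ) ^ k * (3 : ℝ) ^ ((c : ℝ) / 3) * ((n : ℝ) + 1) ^ a := by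
  classical
  have hpoly : PolyBounded fun n =>
      n * (n * 5 + extendCmd.cost n + 4) + (n * 6 + 5) + (4 * n + 6) := by
    have h := PolyBounded.const
    have hid := PolyBounded.id
    exact ((hid.mul (((hid.mul (h 5)).add extendCmd.polyBounded_cost).add (h 4))).add
      ((hid.mul (h 6)).add (h 5))).add (((h 4).mul hid).add (h 6))
  obtain ⟨C, D, hCD⟩ := hpoly
  -- The factor `2` absorbs `⌊E⌋₊ + 1 ≤ 2 * E`, and the additional exponent `2` absorbs the factor
  -- `1 + n ^ 2` in `E`.
  refine ⟨2 * C, D + 2, fun n G S k c hk hc => ?_⟩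
  set E : ℝ := 2 ^ k * ((1 + (n : ℝ) ^ 2) * (3 : ℝ) ^ ((c : ℝ) / 3)) with hE
  have hE1 : 1 ≤ E := by
    have h1 : (1 : ℝ) ≤ 2 ^ k := one_le_pow₀ (by norm_num)
    have h2 : (1 : ℝ) ≤ 1 + (n : ℝ) ^ 2 := by nlinarith [sq_nonneg (n : ℝ)]
    have h3 : (1 : ℝ) ≤ (3 : ℝ) ^ ((c : ℝ) / 3) := Real.one_le_rpow (by norm_num) (by positivity)
    exact one_le_mul_of_one_le_of_one_le h1 (one_le_mul_of_one_le_of_one_le h2 h3)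
  have hB : ∀ i ≤ n, (maxCliques G (Finset.univ.filter fun x : Fin n => x.val < i)).card ≤
      ⌊E⌋₊ := by
    intro i _
    refine Nat.le_floor ?_
    rw [hE, ← hk]
    refine card_maxCliques_le_two_pow_mul S _ ((Finset.card_le_univ _).trans (by simp)) ?_
    intro u hu v hv huv hadj
    -- Common neighbors inside a prefix are among all common neighbors outside `S`.
    refine (Finset.card_le_card fun w hw => ?_).trans_lt (hc.card_lt
      (Finset.mem_sdiff.1 hu).2 (Finset.mem_sdiff.1 hv).2 huv hadj)
    obtain ⟨h1, h2⟩ := Finset.mem_filter.1 hw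
    exact Finset.mem_filter.2 ⟨Finset.mem_univ _, (Finset.mem_sdiff.1 h1).2, h2⟩
  obtain ⟨t, s, hr, ht, hs⟩ := reach_cliqueProg G S hB
  refine ⟨t, s.out, ⟨s, hr, rfl⟩, hs, ?_⟩
  have ht' : t ≤ (⌊E⌋₊ + 1) * (C * (n + 1) ^ D) := by
    refine ht.trans (le_trans ?_ (Nat.mul_le_mul_left _ (hCD n)))
    nlinarith [Nat.zero_le (⌊E⌋₊ * (4 * n + 6)),
      Nat.zero_le (n * (n * 5 + extendCmd.cost n + 4) + (n * 6 + 5))]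
  have hfloor : ((⌊E⌋₊ : ℕ) : ℝ) + 1 ≤ 2 * E := by
    have := Nat.floor_le (zero_le_one.trans hE1)
    linarith
  have hsq : 1 + (n : ℝ) ^ 2 ≤ ((n : ℝ) + 1) ^ 2 := by
    have : (0 : ℝ) ≤ n := by positivity
    nlinarith
  calc (t : ℝ) ≤ ((⌊E⌋₊ : ℕ) + 1) * (C * ((n : ℝ) + 1) ^ D) := by exact_mod_cast ht'
    _ ≤ (2 * (2 ^ k * (((n : ℝ) + 1) ^ 2 * (3 : ℝ) ^ ((c : ℝ) / 3)))) *
        (C * ((n : ℝ) + 1) ^ D) := by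
        refine mul_le_mul_of_nonneg_right (hfloor.trans ?_) (by positivity)
        rw [hE]
        gcongr
    _ = _ := by ring

end CliqueAlgorithm

end AlmostClosed

/-! ### The exchange argument and the branching tree for independent sets -/

namespace AlmostClosed

/-! ### Branching for independent sets -/

section Branching

variable {V : Type*} [LinearOrder V] (G : SimpleGraph V)

open Classical in
/-- The neighbors of `v` in `U` that come after `v`. -/
noncomputable def laterNeighbors (U : Finset V) (v : V) : Finset V :=
  U.filter fun w => v < w ∧ G.Adj v w

/-- The first vertex of `U` with at most `d` later neighbors in `U`. -/
def IsPivot (U : Finset V) (d : ℕ) (v : V) : Prop :=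
  v ∈ U ∧ (laterNeighbors G U v).card ≤ d ∧ ∀ x ∈ U, x < v → d < (laterNeighbors G U x).card

open Classical in
/-- The pivot of `U` and its later neighbors. -/
noncomputable def candidates (U : Finset V) (d : ℕ) : Finset V :=
  U.filter fun u => ∃ v, IsPivot G U d v ∧ (u = v ∨ v < u ∧ G.Adj v u)

variable {G} {U : Finset V} {d : ℕ}

theorem mem_laterNeighbors {v w : V} :
    w ∈ laterNeighbors G U v ↔ w ∈ U ∧ v < w ∧ G.Adj v w := by
  simp [laterNeighbors]

theorem IsPivot.unique {v w : V} (hv : IsPivot G U d v) (hw : IsPivot G U d w) : v = w := by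
  rcases lt_trichotomy v w with h | h | h
  · exact absurd (hw.2.2 v hv.1 h) hv.2.1.not_gt
  · exact h
  · exact absurd (hv.2.2 w hw.1 h) hw.2.1.not_gt

/-- The last vertex of `U` has no later neighbors, so it qualifies for every `d`. -/
theorem exists_isPivot (hU : U.Nonempty) : ∃ v, IsPivot G U d v := by
  classical
  have hne : (U.filter fun v => (laterNeighbors G U v).card ≤ d).Nonempty := by
    refine ⟨U.max' hU, Finset.mem_filter.2 ⟨U.max'_mem hU, ?_⟩⟩
    rw [laterNeighbors, Finset.filter_false_of_mem]
    · simp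
    · exact fun x hx h => (U.le_max' x hx).not_gt h.1
  refine ⟨_, (Finset.mem_filter.1 (Finset.min'_mem _ hne)).1,
    (Finset.mem_filter.1 (Finset.min'_mem _ hne)).2, fun x hx hlt => ?_⟩
  by_contra! h
  exact (Finset.min'_le _ x (Finset.mem_filter.2 ⟨hx, h⟩)).not_gt hlt

theorem mem_candidates {u : V} : u ∈ candidates G U d ↔
    u ∈ U ∧ ∃ v, IsPivot G U d v ∧ (u = v ∨ v < u ∧ G.Adj v u) := by
  simp [candidates]

theorem mem_of_mem_candidates {u : V} (hu : u ∈ candidates G U d) : u ∈ U :=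
  (mem_candidates.1 hu).1

theorem card_candidates_le : (candidates G U d).card ≤ d + 1 := by
  classical
  rcases (candidates G U d).eq_empty_or_nonempty with h | ⟨u, hu⟩
  · simp [h]
  · obtain ⟨-, v, hv, -⟩ := Finset.mem_filter.1 hu
    have : candidates G U d ⊆ insert v (laterNeighbors G U v) := by
      intro x hx
      obtain ⟨hxU, w, hw, hxw⟩ := Finset.mem_filter.1 hx
      obtain rfl := hv.unique hw
      rw [Finset.mem_insert, laterNeighbors, Finset.mem_filter]
      exact hxw.imp_right fun h => ⟨hxU, h⟩
    exact (Finset.card_le_card this).trans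
      ((Finset.card_insert_le _ _).trans (Nat.add_le_add_right hv.2.1 1))

-- An exchange argument: `T` is first moved off all vertices before the pivot `v`. If the result
-- meets `v` or a neighbor of `v`, that vertex is a candidate. Otherwise `v` can replace any member.
open Classical in
theorem exists_mem_candidates {d₀ : ℕ} (hU : ∀ u ∈ U, ∀ v ∈ U, u ≠ v → ¬ G.Adj u v →
      (U.filter fun w => G.Adj u w ∧ G.Adj v w).card ≤ d₀)
    {T : Finset V} (hTU : T ⊆ U) (hT : G.IsIndepSet (T : Set V)) (hne : T.Nonempty)
    (hd : d₀ * T.card ≤ d) :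
    ∃ u ∈ candidates G U d, ∃ T' ⊆ U, G.IsIndepSet (T' : Set V) ∧ T'.card + 1 = T.card ∧
      u ∉ T' ∧ ∀ w ∈ T', ¬ G.Adj u w := by
  obtain ⟨v, hv⟩ := exists_isPivot (G := G) (d := d) (hne.mono hTU)
  -- Vertices to be avoided are treated in increasing order, and each exchange moves to a larger
  -- vertex, so those already avoided stay avoided.
  have key : ∀ P : Finset V, (∀ x ∈ P, x ∈ U → d < (laterNeighbors G U x).card) →
      ∃ T' ⊆ U, G.IsIndepSet (T' : Set V) ∧ T'.card = T.card ∧ ∀ x ∈ P, x ∉ T' := by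
    intro P
    induction P using Finset.induction_on_max with
    | empty => exact fun _ => ⟨T, hTU, hT, rfl, by simp⟩
    | insert a P ha ih =>
      intro hP
      obtain ⟨R, hRU, hR, hcard, hRP⟩ := ih fun x hx => hP x (Finset.mem_insert_of_mem hx)
      by_cases haR : a ∈ R
      · have haU := hRU haR
        -- Each other member of `R` is nonadjacent to `a` and shares at most `d₀` neighbors with it.
        -- Together they block at most `d₀ * T.card ≤ d` vertices, fewer than `a` has later
        -- neighbors.
        have hcov : ((R.erase a).biUnion fun t =>
            U.filter fun w => G.Adj a w ∧ G.Adj t w).card < (laterNeighbors G U a).card := by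
          refine lt_of_le_of_lt ?_ (hP a (Finset.mem_insert_self _ _) haU)
          refine (Finset.card_biUnion_le_card_mul _ _ d₀ fun t ht => ?_).trans
            ((Nat.mul_le_mul_right _ (Finset.card_erase_le)).trans ?_)
          · have ht' := Finset.mem_erase.1 ht
            exact hU a haU t (hRU ht'.2) ht'.1.symm (hR haR ht'.2 ht'.1.symm)
          · rw [hcard, mul_comm]
            exact hd
        obtain ⟨q, hq, hqc⟩ := Finset.exists_mem_notMem_of_card_lt_card hcov
        obtain ⟨hqU, haq, hadj⟩ := Finset.mem_filter.1 hq
        have hqt : ∀ t ∈ R.erase a, ¬ G.Adj q t := fun t ht h =>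
          hqc (Finset.mem_biUnion.2 ⟨t, ht, Finset.mem_filter.2 ⟨hqU, hadj, h.symm⟩⟩)
        have hqR : q ∉ R := fun h => hR haR h haq.ne hadj
        refine ⟨insert q (R.erase a), ?_, ?_, ?_, ?_⟩
        · exact Finset.insert_subset hqU ((Finset.erase_subset _ _).trans hRU)
        · rw [Finset.coe_insert]
          refine Set.Pairwise.insert (hR.mono (by simp)) fun t ht _ => ?_
          exact ⟨hqt t ht, fun h => hqt t ht h.symm⟩
        · rw [Finset.card_insert_of_notMem fun h => hqR (Finset.mem_of_mem_erase h),
            Finset.card_erase_add_one haR, hcard]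
        · intro x hx hxT
          rcases Finset.mem_insert.1 hxT with rfl | hxR
          · rcases Finset.mem_insert.1 hx with rfl | hxP
            · exact haq.false
            · exact (ha x hxP).not_gt haq
          · rcases Finset.mem_insert.1 hx with rfl | hxP
            · exact Finset.notMem_erase _ _ hxR
            · exact hRP x hxP (Finset.mem_of_mem_erase hxR)
      · refine ⟨R, hRU, hR, hcard, fun x hx => ?_⟩
        rcases Finset.mem_insert.1 hx with rfl | hx
        · exact haR
        · exact hRP x hx
  obtain ⟨R, hRU, hR, hcard, hRP⟩ := key (U.filter (· < v)) fun x hx _ =>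
    hv.2.2 x (Finset.mem_filter.1 hx).1 (Finset.mem_filter.1 hx).2
  have hsub : ∀ t, R.erase t ⊆ U := fun t => (Finset.erase_subset _ _).trans hRU
  have hind : ∀ t, G.IsIndepSet ((R.erase t : Finset V) : Set V) := fun t => hR.mono (by simp)
  by_cases h : ∃ t ∈ R, t = v ∨ G.Adj v t
  · obtain ⟨t, ht, htv⟩ := h
    refine ⟨t, Finset.mem_filter.2 ⟨hRU ht, v, hv, ?_⟩, R.erase t, hsub t, hind t, ?_, ?_, ?_⟩
    · rcases htv with h | h
      · exact .inl h
      · refine .inr ⟨lt_of_le_of_ne (not_lt.1 fun hlt => ?_) h.ne, h⟩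
        exact hRP t (Finset.mem_filter.2 ⟨hRU ht, hlt⟩) ht
    · rw [Finset.card_erase_add_one ht, hcard]
    · exact Finset.notMem_erase _ _
    · exact fun w hw => hR ht (Finset.mem_of_mem_erase hw) (Finset.ne_of_mem_erase hw).symm
  · push Not at h
    obtain ⟨t, ht⟩ : R.Nonempty := by rwa [← Finset.card_pos, hcard, Finset.card_pos]
    refine ⟨v, Finset.mem_filter.2 ⟨hv.1, v, hv, .inl rfl⟩, R.erase t, hsub t, hind t, ?_, ?_, ?_⟩
    · rw [Finset.card_erase_add_one ht, hcard]
    · exact fun hvR => (h v (Finset.mem_of_mem_erase hvR)).1 rfl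
    · exact fun w hw => (h w (Finset.mem_of_mem_erase hw)).2

end Branching

/-! ### The levels of the algorithm for independent sets -/

section IndepLevels

variable {n : ℕ} (G : SimpleGraph (Fin n)) (S : Finset (Fin n))

open Classical in
/-- The two ways to decide about the vertex `i` of `S`. -/
noncomputable def selectStep (i : ℕ) (K : Finset (Fin n)) : List (Finset (Fin n)) :=
  if h : i < n then
    K :: if (⟨i, h⟩ : Fin n) ∈ S ∧ ∀ w ∈ K, ¬ G.Adj ⟨i, h⟩ w then [insert ⟨i, h⟩ K] else []
  else []

open Classical in
/-- The vertices outside `S` that can be added to the independent set `K`. -/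
noncomputable def freeSet (K : Finset (Fin n)) : Finset (Fin n) :=
  Finset.univ.filter fun u => u ∉ S ∧ u ∉ K ∧ ∀ w ∈ K, ¬ G.Adj u w

open Classical in
/-- One round of branching. -/
noncomputable def branchStep (d l : ℕ) (K : Finset (Fin n)) : List (Finset (Fin n)) :=
  if K.card < l then
    (List.finRange n).flatMap fun u =>
      if u ∈ candidates G (freeSet G S K) d then [insert u K] else []
  else [K]

variable {G S}

theorem mem_freeSet {K : Finset (Fin n)} {u : Fin n} :
    u ∈ freeSet G S K ↔ u ∉ S ∧ u ∉ K ∧ ∀ w ∈ K, ¬ G.Adj u w := by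
  simp [freeSet]

theorem isIndepSet_insert {K : Finset (Fin n)} {u : Fin n} (hK : G.IsIndepSet (K : Set (Fin n)))
    (hu : ∀ w ∈ K, ¬ G.Adj u w) : G.IsIndepSet ((insert u K : Finset (Fin n)) : Set (Fin n)) := by
  rw [Finset.coe_insert]
  exact Set.Pairwise.insert hK fun t ht _ => ⟨hu t ht, fun h => hu t ht h.symm⟩

theorem isIndepSet_of_mem_selectStep {i : ℕ} {K M : Finset (Fin n)}
    (hK : G.IsIndepSet (K : Set (Fin n))) (hM : M ∈ selectStep G S i K) :
    G.IsIndepSet (M : Set (Fin n)) := by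
  rw [selectStep] at hM
  split_ifs at hM with h1 h2
  · rcases List.mem_cons.1 hM with rfl | hM
    · exact hK
    · obtain rfl := List.mem_singleton.1 hM
      exact isIndepSet_insert hK h2.2
  · obtain rfl := List.mem_singleton.1 hM
    exact hK
  · simp at hM

theorem mem_branchStep {d l : ℕ} {K M : Finset (Fin n)} : M ∈ branchStep G S d l K ↔
    K.card < l ∧ (∃ u ∈ candidates G (freeSet G S K) d, M = insert u K) ∨
      ¬ K.card < l ∧ M = K := by
  rw [branchStep]
  split_ifs with h
  · simp only [List.mem_flatMap, List.mem_finRange, true_and, h, not_true_eq_false, false_and,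
      or_false]
    refine exists_congr fun u => ?_
    split_ifs with hu <;> simp [hu]
  · simp [h]

theorem isIndepSet_of_mem_branchStep {d l : ℕ} {K M : Finset (Fin n)}
    (hK : G.IsIndepSet (K : Set (Fin n))) (hM : M ∈ branchStep G S d l K) :
    G.IsIndepSet (M : Set (Fin n)) := by
  rcases mem_branchStep.1 hM with ⟨-, u, hu, rfl⟩ | ⟨-, rfl⟩
  · exact isIndepSet_insert hK (mem_freeSet.1 (mem_of_mem_candidates hu)).2.2
  · exact hK

theorem forall_mem_levels {step : ℕ → Finset (Fin n) → List (Finset (Fin n))}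
    {L : List (Finset (Fin n))} {p : Finset (Fin n) → Prop} (hL : ∀ K ∈ L, p K)
    (hstep : ∀ i K M, p K → M ∈ step i K → p M) (j : ℕ) : ∀ K ∈ levels step L j, p K := by
  induction j with
  | zero => exact hL
  | succ j ih =>
    intro M hM
    obtain ⟨K, hK, hM⟩ := List.mem_flatMap.1 hM
    exact hstep j K M (ih K hK) hM

theorem length_levels_succ_le {step : ℕ → Finset (Fin n) → List (Finset (Fin n))}
    {L : List (Finset (Fin n))} {j m : ℕ} (h : ∀ K, (step j K).length ≤ m) :
    (levels step L (j + 1)).length ≤ (levels step L j).length * m := by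
  rw [levels, List.length_flatMap]
  refine (List.sum_le_card_nsmul _ m ?_).trans (by simp)
  simpa using fun K _ => h K

/-- Only a vertex of `S` offers a choice; the others pass the list on unchanged. -/
theorem length_levels_selectStep_le (i : ℕ) (hi : i ≤ n) :
    (levels (selectStep G S) [∅] i).length ≤ 2 ^ (S.filter fun x => x.val < i).card := by
  induction i with
  | zero => simp [levels]
  | succ i ih =>
    have ih := ih (by omega)
    by_cases hS : (⟨i, hi⟩ : Fin n) ∈ S
    · have hcard : (S.filter fun x => x.val < i + 1).card =
          (S.filter fun x => x.val < i).card + 1 := by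
        rw [← Finset.card_insert_of_notMem (a := (⟨i, hi⟩ : Fin n)) (by simp)]
        congr 1
        ext x
        simp only [Finset.mem_filter, Finset.mem_insert, Fin.ext_iff]
        constructor
        · rintro ⟨h1, h2⟩
          by_cases hx : x.val = i
          · exact .inl hx
          · exact .inr ⟨h1, by omega⟩
        · rintro (h | ⟨h1, h2⟩)
          · exact ⟨by rwa [show x = ⟨i, hi⟩ from Fin.ext h], by omega⟩
          · exact ⟨h1, by omega⟩
      rw [hcard, pow_succ]
      refine (length_levels_succ_le (m := 2) fun K => ?_).trans (Nat.mul_le_mul_right 2 ih)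
      rw [selectStep]
      split_ifs <;> simp
    · refine (length_levels_succ_le (m := 1) fun K => ?_).trans ?_
      · rw [selectStep]
        split_ifs <;> simp_all
      · rw [mul_one]
        refine ih.trans (Nat.pow_le_pow_right (by norm_num) (Finset.card_le_card ?_))
        exact Finset.monotone_filter_right _ fun x _ h => by omega

theorem mem_levels_selectStep {A : Finset (Fin n)} (hAS : A ⊆ S)
    (hA : G.IsIndepSet (A : Set (Fin n))) (i : ℕ) (hi : i ≤ n) :
    (A.filter fun x => x.val < i) ∈ levels (selectStep G S) [∅] i := by
  induction i with
  | zero => simp [levels]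
  | succ i ih =>
    refine List.mem_flatMap.2 ⟨_, ih (by omega), ?_⟩
    rw [selectStep, dif_pos (Nat.lt_of_succ_le hi)]
    by_cases hiA : (⟨i, hi⟩ : Fin n) ∈ A
    · rw [if_pos]
      · refine List.mem_cons_of_mem _ (List.mem_singleton.2 ?_)
        ext x
        simp only [Finset.mem_filter, Finset.mem_insert, Fin.ext_iff]
        constructor
        · rintro ⟨h1, h2⟩
          by_cases hx : x.val = i
          · exact .inl hx
          · exact .inr ⟨h1, by omega⟩
        · rintro (h | ⟨h1, h2⟩)
          · exact ⟨by rwa [show x = ⟨i, hi⟩ from Fin.ext h], by omega⟩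
          · exact ⟨h1, by omega⟩
      · refine ⟨hAS hiA, fun w hw hadj => ?_⟩
        exact hA hiA (Finset.mem_filter.1 hw).1 hadj.ne hadj
    · refine List.mem_cons.2 (.inl ?_)
      refine Finset.filter_congr fun x hx => ?_
      have : x.val ≠ i := fun h => hiA (by rwa [show (⟨i, hi⟩ : Fin n) = x from Fin.ext h.symm])
      omega

/-- Only candidates contribute, each of them one set. -/
theorem length_branchStep_le (d l : ℕ) (K : Finset (Fin n)) :
    (branchStep G S d l K).length ≤ d + 1 := by
  classical
  rw [branchStep]
  split_ifs with h
  · refine le_trans (le_of_eq ?_) (card_candidates_le (G := G) (U := freeSet G S K) (d := d))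
    have : ((List.finRange n).filter (· ∈ candidates G (freeSet G S K) d)).length =
        (candidates G (freeSet G S K) d).card := by
      rw [← sort_eq_filter_finRange, Finset.length_sort]
    rw [← this, List.length_flatMap, ← List.countP_eq_length_filter]
    induction List.finRange n with
    | nil => rfl
    | cons a l ih =>
      rw [List.map_cons, List.sum_cons, ih, List.countP_cons, add_comm]
      congr 1
      split_ifs <;> simp_all
  · simp

theorem length_levels_branchStep_le (d l : ℕ) (L : List (Finset (Fin n))) (j : ℕ) :
    (levels (fun _ => branchStep G S d l) L j).length ≤ L.length * (d + 1) ^ j := by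
  induction j with
  | zero => simp [levels]
  | succ j ih =>
    refine (length_levels_succ_le (step := fun _ => branchStep G S d l) fun K => length_branchStep_le d l K).trans ?_
    rw [pow_succ, ← mul_assoc]
    exact Nat.mul_le_mul_right _ ih

-- Soundness: all sets produced are independent. Completeness: after `j` rounds some set `K` has
-- reached size `l`, or it has at least `j` members and is completed to size `l` by an independent
-- set `T` of free vertices. A round moves one unit of size from `T` to `K`, possibly after
-- exchanging members of `T`.
open Classical in
theorem hasIndepSet_iff {d₀ l : ℕ} (hd₀ : ∀ u ∉ S, ∀ v ∉ S, u ≠ v → ¬ G.Adj u v →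
      (Finset.univ.filter fun w => w ∉ S ∧ G.Adj u w ∧ G.Adj v w).card ≤ d₀) :
    (∃ K ∈ levels (fun _ => branchStep G S (d₀ * l) l) (levels (selectStep G S) [∅] n) l,
      l ≤ K.card) ↔ HasIndepSet G l := by
  constructor
  · rintro ⟨K, hK, hl⟩
    refine ⟨K, ?_, hl⟩
    refine forall_mem_levels (p := fun K => G.IsIndepSet (K : Set (Fin n))) ?_
      (fun _ K M => isIndepSet_of_mem_branchStep) l K hK
    refine forall_mem_levels ?_ (fun _ K M => isIndepSet_of_mem_selectStep) n
    simp
  · rintro ⟨I, hI, hl⟩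
    have hfull : (I ∩ S) ∈ levels (selectStep G S) [∅] n := by
      have := mem_levels_selectStep (G := G) (S := S) (A := I ∩ S) Finset.inter_subset_right
        (hI.mono (by simp)) n le_rfl
      rwa [Finset.filter_true_of_mem fun x _ => x.2] at this
    suffices H : ∀ j ≤ l, ∃ K ∈ levels (fun _ => branchStep G S (d₀ * l) l)
        (levels (selectStep G S) [∅] n) j, l ≤ K.card ∨ j ≤ K.card ∧ ∃ T ⊆ freeSet G S K,
          G.IsIndepSet (T : Set (Fin n)) ∧ K.card + T.card = l by
      obtain ⟨K, hK, h⟩ := H l le_rfl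
      exact ⟨K, hK, h.elim id fun h => h.1⟩
    intro j hj
    induction j with
    | zero =>
      refine ⟨_, hfull, ?_⟩
      rcases le_or_gt l (I ∩ S).card with h | h
      · exact .inl h
      · have hcard : l - (I ∩ S).card ≤ (I \ S).card := by
          have := Finset.card_sdiff_add_card_inter I S
          omega
        -- `T` is trimmed so that the total size is exactly `l`; then `d₀ * T.card` never exceeds
        -- the threshold `d₀ * l`.
        obtain ⟨T, hTI, hT⟩ := Finset.exists_subset_card_eq hcard
        refine .inr ⟨Nat.zero_le _, T, fun u hu => mem_freeSet.2 ?_, hI.mono ?_, by omega⟩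
        · have hu' := Finset.mem_sdiff.1 (hTI hu)
          refine ⟨hu'.2, fun h => hu'.2 (Finset.mem_inter.1 h).2, fun w hw hadj => ?_⟩
          exact hI hu'.1 (Finset.mem_inter.1 hw).1 hadj.ne hadj
        · exact_mod_cast hTI.trans Finset.sdiff_subset
    | succ j ih =>
      obtain ⟨K, hK, h⟩ := ih (by omega)
      by_cases hKl : l ≤ K.card
      · exact ⟨K, List.mem_flatMap.2 ⟨K, hK, mem_branchStep.2 (.inr ⟨by omega, rfl⟩)⟩, .inl hKl⟩
      · obtain ⟨hjK, T, hTU, hT, hcard⟩ := h.resolve_left hKl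
        obtain ⟨u, hu, T', hT'U, hT', hT'card, huT', huadj⟩ :=
          exists_mem_candidates (d := d₀ * l) (d₀ := d₀) (fun u hu v hv huv hadj =>
            (Finset.card_le_card fun w hw => Finset.mem_filter.2 ⟨Finset.mem_univ _,
              (mem_freeSet.1 (Finset.mem_filter.1 hw).1).1, (Finset.mem_filter.1 hw).2⟩).trans
            (hd₀ u (mem_freeSet.1 hu).1 v (mem_freeSet.1 hv).1 huv hadj))
          hTU hT (Finset.card_pos.1 (by omega)) (Nat.mul_le_mul_left _ (by omega))
        have huF := mem_freeSet.1 (mem_of_mem_candidates hu)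
        refine ⟨insert u K, List.mem_flatMap.2 ⟨K, hK, mem_branchStep.2
          (.inl ⟨by omega, u, hu, rfl⟩)⟩, .inr ?_⟩
        rw [Finset.card_insert_of_notMem huF.2.1]
        refine ⟨by omega, T', fun w hw => ?_, hT', by omega⟩
        have hwF := mem_freeSet.1 (hT'U hw)
        refine mem_freeSet.2 ⟨hwF.1, ?_, ?_⟩
        · rw [Finset.mem_insert, not_or]
          exact ⟨fun h => huT' (h ▸ hw), hwF.2.1⟩
        · intro y hy
          rcases Finset.mem_insert.1 hy with rfl | hy
          · exact fun h => huadj w hw h.symm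
          · exact hwF.2.2 y hy

end IndepLevels

end AlmostClosed

/-! ### From the branching tree to the independent set program -/

namespace AlmostClosed

/-! ### The algorithm for independent sets -/

section IndepAlgorithm

open AlmostClosed.Expr

variable {n : ℕ} {G : SimpleGraph (Fin n)} {S K : Finset (Fin n)} {s : State}

theorem Shows.setReg (h : Shows G S s) {i m : ℕ} (hi : i ≠ 0) : Shows G S (s.setReg i m) :=
  ⟨by simp [h.size, hi.symm], h.adj, h.mem⟩

theorem IsCurrent.setReg (h : IsCurrent K s) {i m : ℕ} : IsCurrent K (s.setReg i m) := h

theorem sat_adj_iff (hs : Shows G S s) {x y : ℕ} {u v : Fin n} (hx : s.reg x = u)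
    (hy : s.reg y = v) : (adj x y).Sat s ↔ G.Adj u v := by
  simp [hs.size, hx, hy, hs.adj, ite_one_zero_pos]

theorem sat_get_one_iff (hs : Shows G S s) {x : ℕ} {u : Fin n} (hx : s.reg x = u) :
    (get 1 x).Sat s ↔ u ∈ S := by
  simp [hx, hs.mem, ite_one_zero_pos]

theorem sat_get_three_iff (hK : IsCurrent K s) {x : ℕ} {u : Fin n} (hx : s.reg x = u) :
    (get 3 x).Sat s ↔ u ∈ K := by
  simp [hx, hK u, ite_one_zero_pos]

/-- No member of the current set is adjacent to the vertex in the register `x`. -/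
def noNeighborExpr (x b : ℕ) : Expr := .all b ((get 3 b).not.or (adj x b).not)

theorem sat_noNeighborExpr (hs : Shows G S s) (hK : IsCurrent K s) {x b : ℕ} {u : Fin n}
    (hx : s.reg x = u) (hb : b ≠ 0) (hbx : b ≠ x) :
    (noNeighborExpr x b).Sat s ↔ ∀ w ∈ K, ¬ G.Adj u w := by
  rw [noNeighborExpr, sat_all hs.size]
  refine forall_congr' fun w => ?_
  rw [sat_or, sat_not, sat_not, sat_get_three_iff hK.setReg (u := w) (by simp),
    sat_adj_iff (hs.setReg hb) (u := u) (v := w) (by simp [hbx.symm, hx]) (by simp),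
    imp_iff_not_or]

/-- The vertex in the register `x` is outside `S` and can be added to the current set. -/
def freeExpr (x b : ℕ) : Expr := (get 1 x).not.and <| (get 3 x).not.and <| noNeighborExpr x b

theorem sat_freeExpr (hs : Shows G S s) (hK : IsCurrent K s) {x b : ℕ} {u : Fin n}
    (hx : s.reg x = u) (hb : b ≠ 0) (hbx : b ≠ x) :
    (freeExpr x b).Sat s ↔ u ∈ freeSet G S K := by
  rw [freeExpr, sat_and, sat_and, sat_not, sat_not, sat_get_one_iff hs hx,
    sat_get_three_iff hK hx, sat_noNeighborExpr hs hK hx hb hbx, mem_freeSet]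

/-- The number of later free neighbors of the vertex in the register `x`. -/
def degreeExpr (x y b : ℕ) : Expr :=
  .count y <| (freeExpr y b).and <| (Expr.lt (reg x) (reg y)).and (adj x y)

theorem eval_degreeExpr (hs : Shows G S s) (hK : IsCurrent K s) {x y b : ℕ} {u : Fin n}
    (hx : s.reg x = u) (hy : y ≠ 0) (hb : b ≠ 0) (hxy : x ≠ y) (hby : b ≠ y) :
    (degreeExpr x y b).eval s = (laterNeighbors G (freeSet G S K) u).card := by
  rw [degreeExpr, eval_count hs.size]
  congr 1
  ext w
  have hx' : (s.setReg y w).reg x = u := by simp [hxy, hx]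
  have hy' : (s.setReg y w).reg y = w := by simp
  rw [mem_laterNeighbors, Finset.mem_filter, sat_and, sat_and, sat_lt_reg,
    sat_freeExpr (hs.setReg hy) hK.setReg hy' hb hby, sat_adj_iff (hs.setReg hy) hx' hy', hx', hy']
  simp

/-- The vertex in the register `6` is the pivot of the free vertices. -/
def pivotExpr : Expr :=
  (freeExpr 6 7).and <| (Expr.lt (reg 3) (degreeExpr 6 7 8)).not.and <|
    .all 7 <| ((freeExpr 7 8).and (.lt (reg 7) (reg 6))).not.or <|
      .lt (reg 3) (degreeExpr 7 8 9)

theorem sat_pivotExpr (hs : Shows G S s) (hK : IsCurrent K s) {v : Fin n} (hv : s.reg 6 = v) :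
    pivotExpr.Sat s ↔ IsPivot G (freeSet G S K) (s.reg 3) v := by
  rw [pivotExpr, IsPivot, sat_and, sat_and, sat_not, sat_lt, sat_all hs.size,
    sat_freeExpr hs hK hv (by simp) (by simp),
    eval_degreeExpr hs hK hv (by simp) (by simp) (by simp) (by simp), Expr.eval, not_lt]
  refine and_congr_right' (and_congr_right' (forall_congr' fun x => ?_))
  have hx : (s.setReg 7 x).reg 7 = x := by simp
  rw [sat_or, sat_not, sat_and, sat_lt_reg, sat_lt,
    sat_freeExpr (hs.setReg (by simp)) hK.setReg hx (by simp) (by simp),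
    eval_degreeExpr (hs.setReg (by simp)) hK.setReg hx (by simp) (by simp) (by simp) (by simp)]
  simp [hv, Expr.eval, imp_iff_not_or, or_assoc]

/-- The vertex in the register `4` is the pivot or one of its later neighbors. -/
def candidateExpr : Expr :=
  (freeExpr 4 6).and <| .ex 6 <| pivotExpr.and <|
    (Expr.eq 4 6).or <| (Expr.lt (reg 6) (reg 4)).and (adj 6 4)

theorem sat_candidateExpr (hs : Shows G S s) (hK : IsCurrent K s) {u : Fin n}
    (hu : s.reg 4 = u) :
    candidateExpr.Sat s ↔ u ∈ candidates G (freeSet G S K) (s.reg 3) := by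
  rw [candidateExpr, mem_candidates, sat_and, sat_ex hs.size,
    sat_freeExpr hs hK hu (by simp) (by simp)]
  refine and_congr_right' (exists_congr fun v => ?_)
  have hv : (s.setReg 6 v).reg 6 = v := by simp
  have hu' : (s.setReg 6 v).reg 4 = u := by simp [hu]
  rw [sat_and, sat_or, sat_and, sat_eq, sat_lt_reg,
    sat_pivotExpr (hs.setReg (by simp)) hK.setReg hv, sat_adj_iff (hs.setReg (by simp)) hv hu',
    hv, hu', Fin.ext_iff]
  simp

/-- The command for a vertex of `S`, which is in the register `2`. -/
def selectCmd : Cmd :=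
  .seq (.app (get 3 5)) <| .ite ((get 1 2).and (noNeighborExpr 2 6))
    (.app ((get 3 5).or (Expr.eq 5 2))) .nil

/-- The command for a round of branching. -/
def branchCmd : Cmd :=
  .ite (.lt (.count 6 (get 3 6)) (reg 1)) (.each candidateExpr ((get 3 5).or (Expr.eq 5 4)))
    (.app (get 3 5))

theorem selectCmd_wf : selectCmd.WF := by
  simp [selectCmd, noNeighborExpr, Cmd.WF, Expr.WF, Expr.all, Expr.ex, Expr.not, Expr.or,
    Expr.and, Expr.eq]

theorem branchCmd_wf : branchCmd.WF := by
  simp [branchCmd, candidateExpr, pivotExpr, degreeExpr, freeExpr, noNeighborExpr, Cmd.WF,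
    Expr.WF, Expr.all, Expr.ex, Expr.not, Expr.or, Expr.and, Expr.eq]

theorem filter_sat_get_three (hK : IsCurrent K s) :
    (Finset.univ.filter fun w : Fin n => (get 3 5).Sat (s.setReg 5 w)) = K := by
  ext w
  rw [Finset.mem_filter, sat_get_three_iff hK.setReg (u := w) (by simp)]
  simp

theorem filter_sat_insert (hK : IsCurrent K s) {x : ℕ} (hx5 : x ≠ 5) {u : Fin n}
    (hx : s.reg x = u) : (Finset.univ.filter fun w : Fin n =>
      ((get 3 5).or (Expr.eq 5 x)).Sat (s.setReg 5 w)) = insert u K := by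
  ext w
  rw [Finset.mem_filter, sat_or, sat_get_three_iff hK.setReg (u := w) (by simp), sat_eq]
  simp [hx5, hx, Fin.ext_iff, or_comm]

theorem eval_card (hs : Shows G S s) (hK : IsCurrent K s) :
    (Expr.count 6 (get 3 6)).eval s = K.card := by
  rw [eval_count hs.size]
  congr 1
  ext w
  rw [Finset.mem_filter, sat_get_three_iff hK.setReg (u := w) (by simp)]
  simp

theorem sem_selectCmd (hs : Shows G S s) (hK : IsCurrent K s) {v : Fin n} (hv : s.reg 2 = v) :
    selectCmd.sem s = selectStep G S v K := by
  classical
  simp only [selectCmd, Cmd.sem, filter_sat_get_three hK, filter_sat_insert hK (by simp) hv,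
    sat_and, sat_get_one_iff hs hv, sat_noNeighborExpr hs hK hv (b := 6) (by simp) (by simp),
    selectStep, Fin.is_lt, dif_pos, Fin.eta, List.singleton_append]

theorem sem_branchCmd (hs : Shows G S s) (hK : IsCurrent K s) :
    branchCmd.sem s = branchStep G S (s.reg 3) (s.reg 1) K := by
  classical
  have h : ∀ u : Fin n, candidateExpr.Sat (s.setReg 4 u) ↔
      u ∈ candidates G (freeSet G S K) (s.reg 3) := fun u => by
    rw [sat_candidateExpr (hs.setReg (by simp)) hK.setReg (u := u) (by simp)]
    simp
  have h' : ∀ u : Fin n, (Finset.univ.filter fun w : Fin n =>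
      ((get 3 5).or (Expr.eq 5 4)).Sat ((s.setReg 4 u).setReg 5 w)) = insert u K := fun u =>
    filter_sat_insert (s := s.setReg 4 u) hK.setReg (by simp) (by simp)
  have hlt : (Expr.lt (.count 6 (get 3 6)) (reg 1)).Sat s ↔ K.card < s.reg 1 := by
    rw [sat_lt, eval_card hs hK, Expr.eval]
  simp only [branchCmd, Cmd.sem, filter_sat_get_three hK, h', h, hlt, branchStep]

/-- The maximum number of common neighbors outside `S` of two nonadjacent vertices outside `S`. -/
def maxCommonExpr : Expr :=
  .count 6 <| .ex 7 <| .ex 8 <| ((Expr.eq 7 8).not.and <| (get 1 7).not.and <|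
    (get 1 8).not.and (adj 7 8).not).and <|
    .lt (reg 6) (.count 9 <| (get 1 9).not.and <| (adj 7 9).and (adj 8 9))

theorem maxCommonExpr_wf : maxCommonExpr.WF 12 := by
  simp [maxCommonExpr, Expr.WF, Expr.ex, Expr.not, Expr.or, Expr.and, Expr.eq]

open Classical in
/-- The number of common neighbors outside `S`. -/
noncomputable def commonCard (G : SimpleGraph (Fin n)) (S : Finset (Fin n)) (u v : Fin n) : ℕ :=
  (Finset.univ.filter fun w => w ∉ S ∧ G.Adj u w ∧ G.Adj v w).card

-- A maximum is expressed by counting: the `j` that lie below some value are exactly those below the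
-- largest value, and no value exceeds `n`.
open Classical in
theorem eval_maxCommonExpr (hs : Shows G S s) : maxCommonExpr.eval s =
    (Finset.univ.filter fun j : Fin n => ∃ u v, (u ≠ v ∧ u ∉ S ∧ v ∉ S ∧ ¬ G.Adj u v) ∧
      j.val < commonCard G S u v).card := by
  rw [maxCommonExpr, eval_count hs.size]
  congr 1
  refine Finset.filter_congr fun j _ => ?_
  have hs6 := hs.setReg (i := 6) (m := j) (by simp)
  rw [sat_ex hs6.size]
  refine exists_congr fun u => ?_
  have hs7 := hs6.setReg (i := 7) (m := u) (by simp)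
  rw [sat_ex hs7.size]
  refine exists_congr fun v => ?_
  have hs8 := hs7.setReg (i := 8) (m := v) (by simp)
  have h7 : (((s.setReg 6 j).setReg 7 u).setReg 8 v).reg 7 = u := by simp
  have h8 : (((s.setReg 6 j).setReg 7 u).setReg 8 v).reg 8 = v := by simp
  rw [sat_and, sat_and, sat_and, sat_and, sat_not, sat_not, sat_not, sat_not, sat_eq, sat_lt,
    sat_get_one_iff hs8 h7, sat_get_one_iff hs8 h8, sat_adj_iff hs8 h7 h8, h7, h8,
    eval_count hs8.size, commonCard, ← Fin.ext_iff]
  have : ∀ w : Fin n, ((get 1 9).not.and ((adj 7 9).and (adj 8 9))).Sat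
      ((((s.setReg 6 j).setReg 7 u).setReg 8 v).setReg 9 w) ↔
      w ∉ S ∧ G.Adj u w ∧ G.Adj v w := by
    intro w
    have hs9 := hs8.setReg (i := 9) (m := w) (by simp)
    rw [sat_and, sat_and, sat_not, sat_get_one_iff hs9 (u := w) (by simp),
      sat_adj_iff hs9 (u := u) (v := w) (by simp) (by simp),
      sat_adj_iff hs9 (u := v) (v := w) (by simp) (by simp)]
  simp [this, Expr.eval]

theorem commonCard_le_eval (hs : Shows G S s) {u v : Fin n} (hu : u ∉ S) (hv : v ∉ S)
    (huv : u ≠ v) (hadj : ¬ G.Adj u v) : commonCard G S u v ≤ maxCommonExpr.eval s := by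
  classical
  have hle : commonCard G S u v ≤ n := by
    rw [commonCard]
    exact (Finset.card_le_univ _).trans (by simp)
  rw [eval_maxCommonExpr hs]
  calc commonCard G S u v = (Finset.univ.filter fun j : Fin n => j.val < commonCard G S u v).card := by
        rw [Fin.card_filter_val_lt, min_eq_right hle]
    _ ≤ _ := Finset.card_le_card (Finset.monotone_filter_right _ fun j _ hj =>
        ⟨u, v, ⟨huv, hu, hv, hadj⟩, hj⟩)

/-- The hypothesis `1 ≤ c` covers the case without nonadjacent pairs, in which the value is `0`. -/
theorem eval_maxCommonExpr_lt (hs : Shows G S s) {c : ℕ} (hc1 : 1 ≤ c)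
    (hc : IsCClosed (deleteVerts G S) c) : maxCommonExpr.eval s < c := by
  classical
  rw [eval_maxCommonExpr hs]
  refine lt_of_le_of_lt (Finset.card_le_card (t := Finset.univ.filter fun j : Fin n =>
    j.val < c - 1) (Finset.monotone_filter_right _ fun j _ hj => ?_)) ?_
  · obtain ⟨u, v, ⟨huv, hu, hv, hadj⟩, hj⟩ := hj
    have := hc.card_lt hu hv huv hadj
    rw [commonCard] at hj
    omega
  · rw [Fin.card_filter_val_lt]
    omega

/-- Put the product of the value of `maxCommonExpr` and the content of the register `1` into the
register `3`. -/
def thresholdCode : Prog :=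
  .seq (maxCommonExpr.code 20) <| .seq (.const 3 0) <| .seq (.const 18 0) <|
    .whileLt 18 1 <| .seq (.const 19 0) <|
      .seq (.whileLt 19 20 <| .seq (.incr 3) (.incr 19)) (.incr 18)

/-- Multiplication is done by nested increments. Its cost depends on `l` and on a value below `c`,
so it is charged to `f`. -/
theorem reach_thresholdCode (hs : Shows G S s) :
    Reach thresholdCode s (maxCommonExpr.cost n +
      (s.reg 1 * (maxCommonExpr.eval s * 3 + 4) + 3)) fun s' =>
      (∀ x < 17, x ≠ 3 → s'.reg x = s.reg x) ∧ s'.arr = s.arr ∧ s'.out = s.out ∧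
      s'.reg 3 = maxCommonExpr.eval s * s.reg 1 := by
  set m := maxCommonExpr.eval s with hm
  refine (Reach.seq (T' := s.reg 1 * (m * 3 + 4) + 3)
    (maxCommonExpr.reach_code (maxCommonExpr_wf.mono (r' := 20) (by simp)) (by simp) s) ?_).mono
    (by rw [hs.size]) fun _ => id
  rintro s₁ ⟨h1, h2, h3, h4⟩
  refine Reach.constSeq <| Reach.constSeq <| (Reach.loop (T := m * 3 + 3) (fun j s' =>
    (∀ x < 17, x ≠ 3 → s'.reg x = s.reg x) ∧ s'.arr = s.arr ∧ s'.out = s.out ∧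
      s'.reg 3 = m * j ∧ s'.reg 18 = j ∧ s'.reg 20 = m) (s.reg 1) ?_ ?_ ?_).mono le_rfl ?_
  · rintro j s' - ⟨k1, -, -, -, k2, -⟩
    rw [k1 1 (by simp) (by simp), k2]
  · rintro j s' hj ⟨k1, k2, k3, k4, k5, k6⟩
    refine Reach.constSeq <| (Reach.seq (T' := 1) (Reach.loop (T := 2) (fun i s' =>
      (∀ x < 17, x ≠ 3 → s'.reg x = s.reg x) ∧ s'.arr = s.arr ∧ s'.out = s.out ∧
      s'.reg 3 = m * j + i ∧ s'.reg 18 = j ∧ s'.reg 19 = i ∧ s'.reg 20 = m) m ?_ ?_ ?_) ?_).mono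
      (by omega) fun _ => id
    · rintro i s'' - ⟨-, -, -, -, -, l1, l2⟩
      rw [l1, l2]
    · rintro i s'' hi ⟨l1, l2, l3, l4, l5, l6, l7⟩
      refine Reach.incrSeq <| Reach.incr ⟨?_, l2, l3, ?_, ?_, ?_, ?_⟩
      · intro x hx hx3
        simp [hx3, l1 x hx hx3, show x ≠ 19 by omega]
      · simp [l4, add_assoc]
      · simp [l5]
      · simp [l6]
      · simp [l7]
    · refine ⟨fun x hx hx3 => ?_, k2, k3, ?_, ?_, ?_, ?_⟩
      · simp [k1 x hx hx3, show x ≠ 19 by omega]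
      · simp [k4]
      · simp [k5]
      · simp
      · simp [k6]
    · rintro s'' ⟨l1, l2, l3, l4, l5, l6, l7⟩
      refine Reach.incr ⟨fun x hx hx3 => ?_, l2, l3, ?_, ?_, ?_⟩
      · simp [l1 x hx hx3, show x ≠ 18 by omega]
      · simp [l4, mul_add]
      · simp [l5]
      · simp [l7]
  · refine ⟨fun x hx hx3 => ?_, h2, h3, ?_, ?_, ?_⟩
    · simp [hx3, h1 x (by omega), show x ≠ 18 by omega]
    · simp
    · simp
    · simp [h4, hm]
  · rintro s' ⟨k1, k2, k3, k4, -, -⟩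
    exact ⟨k1, k2, k3, k4⟩

/-- The current set has at least as many members as the register `1` says. -/
def largeExpr : Expr := (Expr.lt (.count 6 (get 3 6)) (reg 1)).not

theorem largeExpr_wf : largeExpr.WF 12 := by
  simp [largeExpr, Expr.WF, Expr.not]

/-- The program that decides whether there is a large independent set. -/
def indepProg : Prog :=
  .seq initCode <| .seq (roundsCode 0 selectCmd) <| .seq thresholdCode <|
    .seq (roundsCode 1 branchCmd) (testCode largeExpr)

open Classical in
theorem reach_indepProg (G : SimpleGraph (Fin n)) (S : Finset (Fin n)) {c l : ℕ} (hc1 : 1 ≤ c)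
    (hc : IsCClosed (deleteVerts G S) c) {B : ℕ} (hB : 2 ^ S.card * (c * l + 1) ^ l ≤ B) :
    Reach indepProg (inputState G S l)
      (2 + (n * (B * (n * 5 + selectCmd.cost n + 4) + 4) + 2 +
        (maxCommonExpr.cost n + (l * (c * 3 + 4) + 3) +
        (l * (B * (n * 5 + branchCmd.cost n + 4) + 4) + 2 +
        (B * (n * 5 + largeExpr.cost n + 7) + 3)))))
      fun s => s.out = [if HasIndepSet G l then 1 else 0] := by
  have h0 : (inputState G S l).reg 0 = n := (shows_inputState G S l).size
  have hpos : 1 ≤ (c * l + 1) ^ l := Nat.one_le_pow _ _ (by omega)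
  have hlen₁ : ∀ i ≤ n, (levels (selectStep G S) [∅] i).length ≤ 2 ^ S.card := fun i hi =>
    (length_levels_selectStep_le i hi).trans
      (Nat.pow_le_pow_right (by norm_num) (Finset.card_filter_le _ _))
  refine Reach.seq (reach_initCode h0 (by simp [inputState]) (by simp [inputState])
    (by simp [inputState])) ?_
  rintro s ⟨h1, h2, h3, h4⟩
  have hv : Vis (inputState G S l) s := ⟨fun x hx _ => h1 x (by omega) (by omega),
    fun a _ _ => by rw [h2], h3⟩
  have hsh := (shows_inputState G S l).vis hv
  have hsl : s.reg 1 = l := by rw [h1 1 (by simp) (by simp)]; simp [inputState]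
  have hrounds := reach_roundsCode (b := 0) (by simp) (by simp) selectCmd_wf hsh.size h4
    (selectStep G S) (B := B) ?_ ?_
  rotate_left
  · intro v hvn K s' hs' h2' hK
    rw [hsh.size] at hvn
    exact sem_selectCmd (hsh.vis hs') hK (v := ⟨v, hvn⟩) h2'
  · intro v hvn
    rw [hsh.size] at hvn
    exact (hlen₁ v hvn.le).trans ((Nat.le_mul_of_pos_right _ hpos).trans hB)
  rw [hsh.size] at hrounds
  refine Reach.seq hrounds ?_
  rintro s₁ ⟨hv₁, hL₁⟩
  have hsh₁ := hsh.vis hv₁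
  have hs₁l : s₁.reg 1 = l := by rw [hv₁.reg 1 (by simp) (by simp), hsl]
  set d₀ := maxCommonExpr.eval s₁ with hd₀
  have hd₀c : d₀ < c := eval_maxCommonExpr_lt hsh₁ hc1 hc
  refine Reach.seq ((reach_thresholdCode hsh₁).mono ?_ fun _ => id) ?_
  · rw [hs₁l, ← hd₀]
    gcongr
  rintro s₂ ⟨k1, k2, k3, k4⟩
  have hsh₂ : Shows G S s₂ := ⟨by rw [k1 0 (by simp) (by simp), hsh₁.size], by
    rw [k2]
    exact hsh₁.adj, by
    rw [k2]
    exact hsh₁.mem⟩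
  have hs₂l : s₂.reg 1 = l := by rw [k1 1 (by simp) (by simp), hs₁l]
  have hL₂ : Pending (levels (selectStep G S) [∅] n) s₂ := by
    obtain ⟨q, hq, h12, h13⟩ := hL₁
    refine ⟨q, ⟨?_, ?_, ?_⟩, ?_, ?_⟩
    · rw [k1 14 (by simp) (by simp), hq.length]
    · rw [k1 15 (by simp) (by simp), hq.addr]
    · rw [k2]
      exact hq.mem
    · rw [k1 12 (by simp) (by simp), h12]
    · rw [k1 13 (by simp) (by simp), h13]
  rw [← hd₀, hs₁l] at k4
  have hlen₂ : ∀ j ≤ l, (levels (fun _ => branchStep G S (d₀ * l) l)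
      (levels (selectStep G S) [∅] n) j).length ≤ B := by
    intro j hj
    refine (length_levels_branchStep_le _ _ _ _).trans (le_trans ?_ hB)
    refine Nat.mul_le_mul (hlen₁ n le_rfl) ((Nat.pow_le_pow_right (by omega) hj).trans ?_)
    gcongr
  have hrounds := reach_roundsCode (b := 1) (by simp) (by simp) branchCmd_wf hsh₂.size hL₂
    (fun _ => branchStep G S (d₀ * l) l) (B := B) ?_ ?_
  rotate_left
  · intro v _ K s' hs' _ hK
    rw [sem_branchCmd (hsh₂.vis hs') hK, hs'.reg 3 (by simp) (by simp),
      hs'.reg 1 (by simp) (by simp), k4, hs₂l]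
  · intro v hvl
    rw [hs₂l] at hvl
    exact hlen₂ v hvl.le
  rw [hs₂l] at hrounds
  refine Reach.seq hrounds ?_
  rintro s₃ ⟨hv₃, hL₃⟩
  have hsh₃ := hsh₂.vis hv₃
  refine (reach_testCode largeExpr_wf hsh₃.size hL₃ (fun K => l ≤ K.card) ?_).mono ?_ ?_
  · intro K s' hs' hK
    rw [largeExpr, sat_not, sat_lt, eval_card (hsh₃.vis hs') hK, Expr.eval, not_lt,
      hs'.reg 1 (by simp) (by simp), hv₃.reg 1 (by simp) (by simp), hs₂l]
  · have := Nat.mul_le_mul_right (n * 5 + largeExpr.cost n + 7) (hlen₂ l le_rfl)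
    omega
  · intro s₄ hout
    rw [hout, hv₃.out, k3, hv₁.out, h3]
    have := hasIndepSet_iff (G := G) (S := S) (d₀ := d₀) (l := l) fun u hu v hv huv hadj =>
      commonCard_le_eval hsh₁ hu hv huv hadj
    simp [inputState, ← this]

/-- With `N = l + c`, the power bounds the branching tree, and the factor `(3 * N + 5) * (N + 1)`
bounds the number of rounds and the time of the multiplication. -/
theorem computable_bound (C : ℕ) :
    Computable fun N : ℕ => C * ((N * N + 1) ^ N * ((3 * N + 5) * (N + 1))) := by
  have hpow : Primrec₂ fun a b : ℕ => a ^ b :=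
    Primrec₂.unpaired'.1 Nat.Primrec.pow
  have hid : Primrec fun N : ℕ => N := Primrec.id
  have hc : ∀ m : ℕ, Primrec fun _ : ℕ => m := Primrec.const
  refine Primrec.to_comp ?_
  exact Primrec.nat_mul.comp (hc C) (Primrec.nat_mul.comp
    (hpow.comp (Primrec.nat_add.comp (Primrec.nat_mul.comp hid hid) (hc 1)) hid)
    (Primrec.nat_mul.comp
      (Primrec.nat_add.comp (Primrec.nat_mul.comp (hc 3) hid) (hc 5))
      (Primrec.nat_add.comp hid (hc 1))))

open Classical in
theorem exists_indepProg_bound : ∃ (f : ℕ → ℕ) (b : ℕ), Computable f ∧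
    ∀ (n : ℕ) (G : SimpleGraph (Fin n)) (S : Finset (Fin n)) (k c l : ℕ),
      1 ≤ c → S.card = k → IsCClosed (deleteVerts G S) c →
      ∃ t : ℕ, Outputs indepProg (inputState G S l) t [if HasIndepSet G l then 1 else 0] ∧
        t ≤ 2 ^ k * f (l + c) * (n + 1) ^ b := by
  have hpoly : PolyBounded fun n => n * (n * 5 + selectCmd.cost n + 4) + 4 * n +
      maxCommonExpr.cost n + (n * 5 + branchCmd.cost n + 4) +
      (n * 5 + largeExpr.cost n + 7) + 17 := by
    have h := PolyBounded.const
    have hid := PolyBounded.id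
    exact (((((hid.mul (((hid.mul (h 5)).add selectCmd.polyBounded_cost).add (h 4))).add
      ((h 4).mul hid)).add maxCommonExpr.polyBounded_cost).add
      (((hid.mul (h 5)).add branchCmd.polyBounded_cost).add (h 4))).add
      (((hid.mul (h 5)).add largeExpr.polyBounded_cost).add (h 7))).add (h 17)
  obtain ⟨C, D, hCD⟩ := hpoly
  refine ⟨_, D, computable_bound C, fun n G S k c l hc1 hk hc => ?_⟩
  -- The bound may depend on `l + c` only, so `c * l` is replaced by `N * N` and the depth `l` by
  -- `N`.
  set N := l + c with hN
  have hle : 2 ^ S.card * (c * l + 1) ^ l ≤ 2 ^ k * (N * N + 1) ^ N := by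
    rw [hk]
    have h1 : c * l + 1 ≤ N * N + 1 := by
      have := Nat.mul_le_mul (show c ≤ N by omega) (show l ≤ N by omega)
      omega
    exact Nat.mul_le_mul_left _ ((Nat.pow_le_pow_left h1 l).trans
      (Nat.pow_le_pow_right (by omega) (by omega)))
  obtain ⟨t, s, hr, ht, hs⟩ := reach_indepProg G S hc1 hc hle
  refine ⟨t, ⟨s, hr, hs⟩, ht.trans ?_⟩
  set B := 2 ^ k * (N * N + 1) ^ N with hB
  have hB1 : 1 ≤ B := Nat.mul_pos (by positivity) (by positivity)
  have hX := hCD n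
  set X₁ := n * (n * 5 + selectCmd.cost n + 4) with hX₁
  set X₂ := maxCommonExpr.cost n
  set X₃ := n * 5 + branchCmd.cost n + 4
  set X₄ := n * 5 + largeExpr.cost n + 7
  set M := (3 * N + 5) * (N + 1) with hM
  have hM1 : l * (c * 3 + 4) + l * 4 + l + 1 ≤ M := by
    rw [hM, hN]
    nlinarith
  calc 2 + (n * (B * (n * 5 + selectCmd.cost n + 4) + 4) + 2 +
        (X₂ + (l * (c * 3 + 4) + 3) + (l * (B * X₃ + 4) + 2 + (B * X₄ + 3))))
      = B * X₁ + 4 * n + X₂ + l * (c * 3 + 4) + l * 4 + B * (l * X₃) + B * X₄ + 12 := by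
        rw [hX₁]
        ring
    -- As `B` and `M` are at least `1`, every summand is enlarged to a multiple of `B * M`.
    _ ≤ B * (M * (X₁ + 4 * n + X₂ + X₃ + X₄ + 17)) := by
        have hM' : 1 ≤ M := by omega
        have h1 : 4 * n ≤ B * (4 * n) := Nat.le_mul_of_pos_left _ hB1
        have h2 : X₂ ≤ B * X₂ := Nat.le_mul_of_pos_left _ hB1
        have h3 : l * (c * 3 + 4) + l * 4 + 12 ≤ B * (M * 13) :=
          le_trans (by omega) (Nat.le_mul_of_pos_left _ hB1)
        have h4 : X₁ ≤ M * X₁ := Nat.le_mul_of_pos_left _ hM'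
        have h5 : 4 * n ≤ M * (4 * n) := Nat.le_mul_of_pos_left _ hM'
        have h6 : X₂ ≤ M * X₂ := Nat.le_mul_of_pos_left _ hM'
        have h7 : l * X₃ ≤ M * X₃ := Nat.mul_le_mul_right _ (by omega)
        have h8 : X₄ ≤ M * X₄ := Nat.le_mul_of_pos_left _ hM'
        calc _ ≤ B * (X₁ + 4 * n + X₂ + M * 13 + l * X₃ + X₄) := by
              simp only [mul_add] at h1 h2 h3 ⊢
              omega
          _ ≤ _ := Nat.mul_le_mul_left _ (by simp only [mul_add]; omega)
    _ ≤ B * (M * (C * (n + 1) ^ D)) := by gcongr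
    _ = 2 ^ k * (C * ((N * N + 1) ^ N * M)) * (n + 1) ^ D := by
        rw [hB]
        ring

end IndepAlgorithm

end AlmostClosed

open Classical in
theorem mainTheorem11 :
    (∃ (P : AlmostClosed.Prog) (C : ℝ) (a : ℕ),
      ∀ (n : ℕ) (G : SimpleGraph (Fin n)) (S : Finset (Fin n)) (k c : ℕ),
        1 ≤ c → S.card = k → AlmostClosed.IsCClosed (AlmostClosed.deleteVerts G S) c →
        ∃ (t : ℕ) (w : List ℕ),
          AlmostClosed.Outputs P (AlmostClosed.inputState G S 0) t w ∧
          AlmostClosed.EnumeratesMaximalCliques G w ∧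
          (t : ℝ) ≤ C * (2 : ℝ) ^ k * (3 : ℝ) ^ ((c : ℝ) / 3) * ((n : ℝ) + 1) ^ a) ∧
    (∃ (Q : AlmostClosed.Prog) (f : ℕ → ℕ) (b : ℕ), Computable f ∧
      ∀ (n : ℕ) (G : SimpleGraph (Fin n)) (S : Finset (Fin n)) (k c l : ℕ),
        1 ≤ c → S.card = k → AlmostClosed.IsCClosed (AlmostClosed.deleteVerts G S) c →
        ∃ t : ℕ,
          AlmostClosed.Outputs Q (AlmostClosed.inputState G S l) t
            [if AlmostClosed.HasIndepSet G l then 1 else 0] ∧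
          t ≤ 2 ^ k * f (l + c) * (n + 1) ^ b) := by
  obtain ⟨C, a, h⟩ := AlmostClosed.exists_cliqueProg_bound
  exact ⟨⟨AlmostClosed.cliqueProg, C, a, fun n G S k c _ => h n G S k c⟩,
    AlmostClosed.indepProg, AlmostClosed.exists_indepProg_bound⟩
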